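/- Let $(X,\|\cdot\|)$ be a finite-dimensional real normed space with $\dim X\ge 2$, and let $\|\cdot\|_*$ denote the dual norm on $X^*$. For $f:E\to\mathbb{R}$ with $E\subset X$, put $\operatorname{lip}(f,E):=\inf\{L>0:\ |f(x)-f(y)|\le L\|x-y\|\ \text{for all }x,y\in E\}$. Let $\Omega\subset X$ be open and let $u_0:\overline{\Omega}\to\mathbb{R}$ be a $1$-Lipschitz function (that is, $|u_0(x)-u_0(y)|\le\|x-y\|$ for all $x,y\in\overline\Omega$) such that $\operatorname{lip}(u_0,\partial\Omega)<1$. Then for every $\varepsilon>0$ there exists a $1$-Lipschitz function $w:\overline{\Omega}\to\mathbb{R}$ which is differentiable at every point of $\Omega$ and satisfies $\|Dw(x)\|_*=1$ for almost every $x\in\Omega$ (with respect to Lebesgue measure on $X$), $w=u_0$ on $\partial\Omega$, and $|u_0(x)-w(x)|\le\varepsilon$ for all $x\in\overline{\Omega}$. -/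

import Mathlib

open scoped NNReal ENNReal

/-- The Lipschitz constant `lip(f, E)` of a real function `f` on a subset `E` of a metric space:
the infimum of all `L > 0` such that `|f x - f y| ≤ L * d(x, y)` for all `x, y ∈ E`.
It takes values in `[0, ∞]`; it is `∞` exactly when `f` is not Lipschitz on `E`. -/
noncomputable def lipConst {X : Type*} [PseudoMetricSpace X] (f : X → ℝ) (E : Set X) : ℝ≥0∞ :=
  ⨅ (L : ℝ≥0) (_ : 0 < L ∧ ∀ x ∈ E, ∀ y ∈ E, |f x - f y| ≤ L * dist x y), (L : ℝ≥0∞)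

/-!
# Everywhere differentiable almost everywhere solutions of the eikonal equation

The function `w` is the sum of a smooth function `w₀` with `‖Dw₀‖ < 1` and of tiny, rapidly
oscillating waves `g n` with compact support. The starting function comes from moving `u₀` slightly
towards a Lipschitz extension of its boundary values (`exists_locally_strict_lipschitz`) and
smoothing it (`exists_smoothing`). The wave covector is locally constant, so the `n`-th wave moves the
derivative at each point nearly along a segment; it acts only where the derivative is at distance
about `rate n` or more from the unit sphere, with an amplitude proportional to `rate n`. As `rate n`
tends to `0`, the limit is differentiable wherever the derivatives of the partial sums converge
(`hasFDerivAt_limit`): at each scale at most one wave is neither nearly affine nor negligible, and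
that wave has a small derivative.

Convergence of the derivatives at *every* point of `Ω` is the heart of the matter. The derivatives
play a game: at each turn they are moved along a line, by an amount and in a sense beyond control,
but the line can be chosen. Fix two functionals `ξ`, `ζ` spanning a plane with coordinates `(x, y)`
and use lines of direction `ξ + m ζ`, where the slope `m = ∑ ± θ_k` depends on the past: for each of
countably many bands `|x - q_k| < r_k`, the sign is `+` once `x` has been on the left of the band and
`-` once it has been on its right, and it does not change inside. The intercept
`y - ∑ ± θ_k (x - q_k)` is then constant between switches, up to summable errors, and each crossing of the
band `k` raises it by at least `2 θ_k r_k`. Since it is bounded, each band is crossed finitely often,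
so that `x` converges, and then so does `y` (`game_converges`). To make the line a locally constant function of
the point, the derivative is replaced, at each stage, by an approximation which is locally constant on
an open set of full measure (`exists_locallyConstant_approx`), and the wave is supported in this set.
A point which leaves these sets is never moved again.

The derivative of the limit has norm `1` almost everywhere because a wave raises the weighted integral
of the squared derivative in the direction `e₁` by half the mean square of its amplitude
(`tendsto_secondMoment_wave`). These integrals are bounded and `rate n ^ 2` is not summable, so the
points which are moved at all late stages form a null set (`measure_always_moved_eq_zero`).
-/

open Filter Topology MeasureTheory Set

/-! ### The line game in the plane -/

/-- The weight `θ` of the band with centre `k.1` and half-width `1 / (k.2 + 1)`. The factor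
`1 / (1 + |k.1|)` makes the bends of all bands summable on bounded sets. -/
noncomputable def bandWeight (k : ℚ × ℕ) : ℝ :=
  (1 / 2) ^ Encodable.encode k / (1 + |(k.1 : ℝ)|)

/-- The sign of the state of a band: `1` for `true` (left of the band), `-1` for `false`. -/
def stateSign (b : Bool) : ℝ := if b then 1 else -1

/-- The slope `∑ ± θ` of the line offered in the game when the bands are in the state `σ`. -/
noncomputable def bandSlope (σ : ℚ × ℕ → Bool) : ℝ := ∑' k, stateSign (σ k) * bandWeight k

open Classical in
/-- The hysteresis rule: a band is in the state `true` once `x` has been on its left, in the state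
`false` once `x` has been on its right, and keeps its state while `x` is inside the band. -/
noncomputable def bandUpdate (x : ℝ) (σ : ℚ × ℕ → Bool) : ℚ × ℕ → Bool := fun k =>
  if x ≤ k.1 - 1 / ((k.2 : ℝ) + 1) then true
  else if k.1 + 1 / ((k.2 : ℝ) + 1) ≤ x then false
  else σ k

theorem bandWeight_pos (k : ℚ × ℕ) : 0 < bandWeight k := by
  unfold bandWeight; positivity

theorem abs_stateSign (b : Bool) : |stateSign b| = 1 := by
  unfold stateSign; split_ifs <;> simp

theorem bandWeight_mul_abs_sub_le (k : ℚ × ℕ) (x : ℝ) :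
    bandWeight k * |x - k.1| ≤ (1 / 2) ^ Encodable.encode k * (1 + |x|) := by
  unfold bandWeight
  rw [div_mul_eq_mul_div, div_le_iff₀ (by positivity), mul_assoc]
  have h : |x - (k.1 : ℝ)| ≤ |x| + |(k.1 : ℝ)| := abs_sub _ _
  have h2 : |x - (k.1 : ℝ)| ≤ (1 + |x|) * (1 + |(k.1 : ℝ)|) := by
    nlinarith [abs_nonneg x, abs_nonneg (k.1 : ℝ)]
  gcongr

theorem bandWeight_le (k : ℚ × ℕ) : bandWeight k ≤ (1 / 2) ^ Encodable.encode k := by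
  unfold bandWeight
  exact div_le_self (by positivity) (by linarith [abs_nonneg (k.1 : ℝ)])

theorem summable_bandWeight : Summable bandWeight :=
  Summable.of_nonneg_of_le (fun k => (bandWeight_pos k).le) bandWeight_le
    summable_geometric_two_encode

theorem norm_stateSign_mul_bandWeight (σ : ℚ × ℕ → Bool) (k : ℚ × ℕ) :
    ‖stateSign (σ k) * bandWeight k‖ = bandWeight k := by
  rw [norm_mul, Real.norm_eq_abs, abs_stateSign, one_mul, Real.norm_of_nonneg (bandWeight_pos k).le]

theorem summable_stateSign_mul_bandWeight (σ : ℚ × ℕ → Bool) :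
    Summable fun k => stateSign (σ k) * bandWeight k :=
  Summable.of_norm_bounded summable_bandWeight
    fun k => (norm_stateSign_mul_bandWeight σ k).le

theorem abs_bandSlope_le (σ : ℚ × ℕ → Bool) : |bandSlope σ| ≤ ∑' k, bandWeight k := by
  rw [← Real.norm_eq_abs]
  exact tsum_of_norm_bounded summable_bandWeight.hasSum
    fun k => (norm_stateSign_mul_bandWeight σ k).le

theorem norm_bend_le (σ : ℚ × ℕ → Bool) (x : ℝ) (k : ℚ × ℕ) :
    ‖stateSign (σ k) * bandWeight k * (x - k.1)‖
      ≤ (1 / 2) ^ Encodable.encode k * (1 + |x|) := by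
  rw [norm_mul, norm_stateSign_mul_bandWeight, Real.norm_eq_abs]
  exact bandWeight_mul_abs_sub_le k x

theorem summable_bend (σ : ℚ × ℕ → Bool) (x : ℝ) :
    Summable fun k : ℚ × ℕ => stateSign (σ k) * bandWeight k * (x - k.1) :=
  Summable.of_norm_bounded (summable_geometric_two_encode.mul_right _) (norm_bend_le σ x)

/-- Each switch of a band raises the intercept of the line by `θ` times twice the distance to the
centre of the band. -/
theorem switch_gain_nonneg (x : ℝ) (σ : ℚ × ℕ → Bool) (k : ℚ × ℕ) :
    0 ≤ (stateSign (σ k) - stateSign (bandUpdate x σ k)) * bandWeight k * (x - k.1) ∧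
    (bandUpdate x σ k ≠ σ k → 2 * bandWeight k * (1 / ((k.2 : ℝ) + 1)) ≤
      (stateSign (σ k) - stateSign (bandUpdate x σ k)) * bandWeight k * (x - k.1)) := by
  have hθ := bandWeight_pos k
  have hr : 0 < 1 / ((k.2 : ℝ) + 1) := by positivity
  unfold bandUpdate
  generalize 1 / ((k.2 : ℝ) + 1) = r at hr ⊢
  generalize (k.1 : ℝ) = q at *
  generalize bandWeight k = θ at hθ ⊢
  have key : (if x ≤ q - r then true else if q + r ≤ x then false else σ k) = σ k ∨
      (σ k = false ∧ x ≤ q - r ∧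
        (if x ≤ q - r then true else if q + r ≤ x then false else σ k) = true) ∨
      (σ k = true ∧ q + r ≤ x ∧
        (if x ≤ q - r then true else if q + r ≤ x then false else σ k) = false) := by
    cases σ k <;> split_ifs with h1 h2 <;> simp [*]
  rcases key with h | ⟨h, hx, h'⟩ | ⟨h, hx, h'⟩
  · rw [h]; simp
  · rw [h', h]; simp only [stateSign]
    constructor
    · simp; nlinarith
    · intro _; simp; nlinarith
  · rw [h', h]; simp only [stateSign]
    constructor
    · simp; nlinarith
    · intro _; simp; nlinarith

/-- The line game in the plane: a player moves a point `(x, y)` in a bounded set, at each turn along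
the line of slope `bandSlope σ` through the current point, up to a summable error. The hysteresis rule
for `σ` forces the point to converge. -/
theorem game_converges {x y t a b : ℕ → ℝ} {σ : ℕ → ℚ × ℕ → Bool} {R : ℝ}
    (hσ : ∀ n, σ (n + 1) = bandUpdate (x (n + 1)) (σ n))
    (hx : ∀ n, |x n| ≤ R) (hy : ∀ n, |y n| ≤ R)
    (hxs : ∀ n, x (n + 1) = x n + t n + a n)
    (hys : ∀ n, y (n + 1) = y n + t n * bandSlope (σ n) + b n)
    (ha : Summable fun n => |a n|) (hb : Summable fun n => |b n|) :
    (∃ x', Tendsto x atTop (𝓝 x')) ∧ ∃ y', Tendsto y atTop (𝓝 y') := by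
  set M := ∑' k, bandWeight k
  -- the intercept of the current line
  set B : ℕ → ℝ := fun n => ∑' k : ℚ × ℕ, stateSign (σ n k) * bandWeight k * (x n - k.1) with hB
  set h : ℕ → ℝ := fun n => y n - B n with hh
  set gain : ℕ → ℚ × ℕ → ℝ := fun n k =>
    (stateSign (σ n k) - stateSign (σ (n + 1) k)) * bandWeight k * (x (n + 1) - k.1) with hgain
  set err : ℕ → ℝ := fun n => b n - a n * bandSlope (σ n) with herr
  have hgain0 : ∀ n k, 0 ≤ gain n k := fun n k => by
    simp only [hgain, hσ n]; exact (switch_gain_nonneg _ _ _).1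
  have hgs : ∀ n, Summable (gain n) := fun n => by
    refine ((summable_bend (σ n) (x (n + 1))).sub (summable_bend (σ (n + 1)) (x (n + 1)))).congr ?_
    intro k; simp only [hgain]; ring
  have hstep : ∀ n, h (n + 1) = h n + err n + ∑' k, gain n k := by
    intro n
    have h1 : ∑' k, gain n k =
        (∑' k : ℚ × ℕ, stateSign (σ n k) * bandWeight k * (x (n + 1) - k.1)) - B (n + 1) := by
      rw [hB, ← (summable_bend (σ n) (x (n + 1))).tsum_sub (summable_bend (σ (n + 1)) (x (n + 1)))]
      congr 1; ext k; simp only [hgain]; ring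
    have h2 : (∑' k : ℚ × ℕ, stateSign (σ n k) * bandWeight k * (x (n + 1) - k.1)) =
        B n + bandSlope (σ n) * (t n + a n) := by
      rw [hB, bandSlope, ← tsum_mul_right, ← (summable_bend (σ n) (x n)).tsum_add
        ((summable_stateSign_mul_bandWeight (σ n)).mul_right _)]
      congr 1; ext k; rw [hxs]; ring
    rw [h1, h2]; simp only [hh, herr]; rw [hys]; ring
  have hBb : ∀ n, |B n| ≤ (∑' k : ℚ × ℕ, (1 / 2 : ℝ) ^ Encodable.encode k) * (1 + R) := by
    intro n
    rw [← tsum_mul_right, ← Real.norm_eq_abs]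
    refine tsum_of_norm_bounded (summable_geometric_two_encode.mul_right _).hasSum
      fun k => (norm_bend_le _ _ k).trans ?_
    have := hx n
    gcongr
  set C := (∑' k : ℚ × ℕ, (1 / 2 : ℝ) ^ Encodable.encode k) * (1 + R)
  have herrs : Summable fun n => |err n| := by
    refine Summable.of_nonneg_of_le (fun _ => abs_nonneg _) (fun n => ?_) (hb.add (ha.mul_right M))
    simp only [herr]
    refine (abs_sub _ _).trans ?_
    rw [abs_mul]
    gcongr
    exact abs_bandSlope_le _
  have herrs' : Summable err := herrs.of_abs
  have hsumG : ∀ n, ∑ i ∈ Finset.range n, ∑' k, gain i k =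
      h n - h 0 - ∑ i ∈ Finset.range n, err i := by
    intro n
    induction n with
    | zero => simp
    | succ n ih => rw [Finset.sum_range_succ, Finset.sum_range_succ, ih, hstep]; ring
  have hG0 : ∀ n, 0 ≤ ∑' k, gain n k := fun n => tsum_nonneg (hgain0 n)
  have hGs : Summable fun n => ∑' k, gain n k := by
    refine summable_of_sum_range_le (c := 2 * (R + C) + ∑' n, |err n|) hG0 fun n => ?_
    rw [hsumG]
    have h1 : |∑ i ∈ Finset.range n, err i| ≤ ∑' n, |err n| :=
      (Finset.abs_sum_le_sum_abs _ _).trans (herrs.sum_le_tsum _ fun _ _ => abs_nonneg _)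
    have h2 : ∀ n, |h n| ≤ R + C := fun n =>
      (abs_sub _ _).trans (add_le_add (hy n) (hBb n))
    have := abs_le.1 (h2 n); have := abs_le.1 (h2 0); have := abs_le.1 h1
    linarith
  -- a band switches only finitely often
  have hconst : ∀ k, ∀ᶠ n in atTop, σ (n + 1) k = σ n k := by
    intro k
    have hk0 : Tendsto (fun n => gain n k) atTop (𝓝 0) :=
      squeeze_zero (fun n => hgain0 n k)
        (fun n => (hgs n).le_tsum k fun j _ => hgain0 n j) hGs.tendsto_atTop_zero
    have hpos : 0 < 2 * bandWeight k * (1 / ((k.2 : ℝ) + 1)) := by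
      have := bandWeight_pos k; positivity
    filter_upwards [hk0.eventually (gt_mem_nhds hpos)] with n hn
    by_contra hne
    have := (switch_gain_nonneg (x (n + 1)) (σ n) k).2 (by rwa [← hσ n])
    rw [← hσ n] at this
    exact absurd hn (not_lt.2 this)
  have hev : ∀ k, ∃ s, ∀ᶠ n in atTop, σ n k = s := by
    intro k
    obtain ⟨N, hN⟩ := eventually_atTop.1 (hconst k)
    refine ⟨σ N k, eventually_atTop.2 ⟨N, fun n hn => ?_⟩⟩
    induction n, hn using Nat.le_induction with
    | base => rfl
    | succ n hn ih => rw [hN n hn, ih]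
  choose s hs using hev
  -- an oscillation of `x` across two rationals would cross a band infinitely often
  have hxlim : ∃ x', Tendsto x atTop (𝓝 x') := by
    refine tendsto_of_no_upcrossings (s := Set.range ((↑) : ℚ → ℝ)) Rat.denseRange_cast ?_
      ⟨R, eventually_map.2 (Eventually.of_forall fun n => (abs_le.1 (hx n)).2)⟩
      ⟨-R, eventually_map.2 (Eventually.of_forall fun n => (abs_le.1 (hx n)).1)⟩
    rintro _ ⟨p, rfl⟩ _ ⟨q, rfl⟩ hpq ⟨hlo, hhi⟩
    obtain ⟨j, hj⟩ := exists_nat_one_div_lt (half_pos (sub_pos.2 hpq))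
    have hstate : ∀ n, ∀ k, σ (n + 1) k = bandUpdate (x (n + 1)) (σ n) k := fun n k => by rw [hσ n]
    have hrj : 0 < 1 / ((j : ℝ) + 1) := by positivity
    have hshift : ∀ {P : ℕ → Prop}, (∃ᶠ n in atTop, P n) → ∃ᶠ n in atTop, P (n + 1) := by
      intro P hP
      rw [frequently_atTop] at hP ⊢
      intro N
      obtain ⟨n, hn, hPn⟩ := hP (N + 1)
      exact ⟨n - 1, by omega, by rwa [Nat.sub_add_cancel (by omega)]⟩
    set k : ℚ × ℕ := ((p + q) / 2, j)
    have hs' : ∀ᶠ n in atTop, σ (n + 1) k = s k := (tendsto_add_atTop_nat 1).eventually (hs k)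
    obtain ⟨n, hn, hn'⟩ := ((hshift hlo).and_eventually hs').exists
    obtain ⟨m, hm, hm'⟩ := ((hshift hhi).and_eventually hs').exists
    have h1 : σ (n + 1) k = true := by
      rw [hstate, bandUpdate, if_pos]
      simp only [k]; push_cast; linarith
    have h2 : σ (m + 1) k = false := by
      rw [hstate, bandUpdate, if_neg, if_pos]
      · simp only [k]; push_cast; linarith
      · simp only [k]; push_cast; linarith
    rw [hn'] at h1; rw [hm'] at h2; rw [h1] at h2; cases h2
  obtain ⟨x', hx'⟩ := hxlim
  refine ⟨⟨x', hx'⟩, ?_⟩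
  -- each state is eventually constant, so the bends converge by dominated convergence
  have hBlim : Tendsto B atTop
      (𝓝 (∑' k : ℚ × ℕ, stateSign (s k) * bandWeight k * (x' - k.1))) := by
    refine tendsto_tsum_of_dominated_convergence
      (bound := fun k : ℚ × ℕ => (1 / 2 : ℝ) ^ Encodable.encode k * (1 + R))
      (summable_geometric_two_encode.mul_right _) (fun k => ?_)
      (Eventually.of_forall fun n k => (norm_bend_le _ _ k).trans ?_)
    · refine Tendsto.mul ?_ (hx'.sub_const _)
      refine (tendsto_const_nhds (x := stateSign (s k) * bandWeight k)).congr' ?_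
      filter_upwards [hs k] with n hn
      rw [hn]
    · have := hx n
      gcongr
  have hhlim : Tendsto h atTop (𝓝 (h 0 + ∑' n, err n + ∑' n, ∑' k, gain n k)) := by
    refine ((tendsto_const_nhds.add herrs'.hasSum.tendsto_sum_nat).add
      hGs.hasSum.tendsto_sum_nat).congr fun n => ?_
    rw [hsumG]; ring
  exact ⟨_, (hhlim.add hBlim).congr fun n => by simp only [hh]; ring⟩

/-! ### Locally constant approximation -/

/-- A function with values in a compact set is, up to a null set and a uniformly small error,
locally constant on an open set. -/
theorem exists_locallyConstant_approx {X F : Type*} [TopologicalSpace X] [MeasurableSpace X]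
    [PseudoMetricSpace F] [SecondCountableTopology F] [MeasurableSpace F] [OpensMeasurableSpace F]
    [Inhabited F]
    (μ : Measure X) [SFinite μ] {V : Set X} (hV : IsOpen V)
    {G : X → F} (hG : ContinuousOn G V) (hGm : Measurable G) {K : Set F} (hK : TotallyBounded K)
    (hGK : ∀ z ∈ V, G z ∈ K) {δ : ℝ} (hδ : 0 < δ) :
    ∃ V' ⊆ V, IsOpen V' ∧ μ (V \ V') = 0 ∧ ∃ P : X → F,
      (∀ z ∈ V', ∀ᶠ z' in 𝓝 z, P z' = P z) ∧ ∀ z ∈ V', dist (P z) (G z) ≤ δ := by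
  classical
  obtain ⟨t, htf, ht⟩ := Metric.totallyBounded_iff.1 hK (δ / 2) (half_pos hδ)
  -- a radius for which all spheres around the net have null preimage
  have hcount : (⋃ c ∈ t, {r : ℝ | 0 < μ {z | dist (G z) c = r}}).Countable :=
    htf.countable.biUnion fun c _ =>
      Measure.countable_meas_level_set_pos (hGm.dist measurable_const)
  obtain ⟨r, hr, hrt⟩ : ∃ r ∈ Ioo (δ / 2) δ, r ∉ ⋃ c ∈ t, {r : ℝ | 0 < μ {z | dist (G z) c = r}} := by
    by_contra! h
    exact (Cardinal.Real.Ioo_countable_iff.not.2 (by push Not; linarith)) (hcount.mono h)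
  have hr0 : ∀ c ∈ t, μ {z | dist (G z) c = r} = 0 := by
    simpa using hrt
  set T := htf.toFinset
  set I : X → Finset F := fun z => T.filter fun c => dist (G z) c < r with hI
  have hIne : ∀ z ∈ V, (I z).Nonempty := by
    intro z hz
    obtain ⟨c, hc, hzc⟩ := mem_iUnion₂.1 (ht (hGK z hz))
    exact ⟨c, Finset.mem_filter.2 ⟨htf.mem_toFinset.2 hc, (Metric.mem_ball.1 hzc).trans hr.1⟩⟩
  set V' := V ∩ ⋂ c ∈ t, {z | dist (G z) c ≠ r}
  have hnear : ∀ z ∈ V', ∀ᶠ z' in 𝓝 z, z' ∈ V ∧ ∀ c ∈ t, dist (G z') c ≠ r ∧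
      (dist (G z') c < r ↔ dist (G z) c < r) := by
    intro z hz
    refine (hV.eventually_mem hz.1).and ((eventually_all_finite htf).2 fun c hc => ?_)
    have hcont : Tendsto (fun z' => dist (G z') c) (𝓝 z) (𝓝 (dist (G z) c)) :=
      ((hG.continuousAt (hV.mem_nhds hz.1)).dist continuousAt_const)
    have hne : dist (G z) c ≠ r := mem_iInter₂.1 hz.2 c hc
    rcases hne.lt_or_gt with h | h
    · filter_upwards [hcont.eventually (gt_mem_nhds h)] with z' hz'
      exact ⟨hz'.ne, iff_of_true hz' h⟩
    · filter_upwards [hcont.eventually (lt_mem_nhds h)] with z' hz'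
      exact ⟨hz'.ne', iff_of_false (not_lt.2 (le_of_lt hz')) (not_lt.2 h.le)⟩
  refine ⟨V', inter_subset_left, ?_, ?_, fun z => if h : (I z).Nonempty then h.choose else default,
    ?_, ?_⟩
  · rw [isOpen_iff_mem_nhds]
    intro z hz
    filter_upwards [hnear z hz] with z' hz'
    exact ⟨hz'.1, mem_iInter₂.2 fun c hc => (hz'.2 c hc).1⟩
  · refine measure_mono_null (t := ⋃ c ∈ t, {z | dist (G z) c = r}) ?_
      ((measure_biUnion_null_iff htf.countable).2 hr0)
    rintro z ⟨hz, hz'⟩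
    by_contra h
    exact hz' ⟨hz, mem_iInter₂.2 fun c hc hzc => h (mem_iUnion₂.2 ⟨c, hc, hzc⟩)⟩
  · intro z hz
    filter_upwards [hnear z hz] with z' hz'
    have : I z' = I z := Finset.filter_congr fun c hc => (hz'.2 c (htf.mem_toFinset.1 hc)).2
    simp only [this]
  · intro z hz
    have hne := hIne z hz.1
    simp only [dif_pos hne]
    have := (Finset.mem_filter.1 hne.choose_spec).2
    rw [dist_comm]; linarith [hr.2]

/-! ### Waves with locally constant wave covector -/

section Oscillation

variable {X : Type*} [NormedAddCommGroup X] [NormedSpace ℝ X]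

theorem integrable_of_support_subset_isCompact {X : Type*} [TopologicalSpace X] [T2Space X]
    [MeasurableSpace X] [BorelSpace X] {μ : Measure X}
    [IsFiniteMeasureOnCompacts μ] {f : X → ℝ} {K : Set X} (hK : IsCompact K)
    (hf : ContinuousOn f K) (hs : Function.support f ⊆ K) : Integrable f μ :=
  (integrableOn_iff_integrable_of_support_subset hs).1 (hf.integrableOn_compact hK)

theorem contDiff_of_contDiffAt_tsupport {f : X → ℝ} {n : WithTop ℕ∞}
    (h : ∀ z ∈ tsupport f, ContDiffAt ℝ n f z) : ContDiff ℝ n f := by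
  refine contDiff_iff_contDiffAt.2 fun z => ?_
  by_cases hz : z ∈ tsupport f
  · exact h z hz
  · exact contDiffAt_const.congr_of_eventuallyEq (notMem_tsupport_iff_eventuallyEq.1 hz)

theorem integral_fderiv_apply_eq_zero [FiniteDimensional ℝ X] [MeasurableSpace X] [BorelSpace X]
    (μ : Measure X) [μ.IsAddHaarMeasure] {F : X → ℝ} (hF : ContDiff ℝ 1 F)
    (hc : HasCompactSupport F) (e : X) : ∫ z, fderiv ℝ F z e ∂μ = 0 := by
  have h := integral_mul_fderiv_eq_neg_fderiv_mul_of_integrable (μ := μ) (f := F)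
    (g := fun _ => (1 : ℝ)) (v := e) ?_ ?_ ?_ ?_ ?_
  · simpa using h
  · simp only [mul_one]
    exact ((hF.continuous_fderiv one_ne_zero).clm_apply continuous_const).integrable_of_hasCompactSupport
      (hc.fderiv_apply ℝ e)
  · simp
  · simpa using hF.continuous.integrable_of_hasCompactSupport hc
  · exact fun x _ => (hF.differentiable one_ne_zero) x
  · exact fun x _ => differentiableAt_const _

/-- A wave of amplitude `b` and frequency `N` whose wave covector `v z` may depend on the place. -/
noncomputable def wave (b : X → ℝ) (v : X → X →L[ℝ] ℝ) (N : ℝ) (z : X) : ℝ :=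
  b z * Real.sin (N * v z z) / N

variable {V : Set X} {v : X → X →L[ℝ] ℝ} {b : X → ℝ}

theorem eventuallyEq_phase (hv : ∀ z ∈ V, ∀ᶠ z' in 𝓝 z, v z' = v z) {z : X} (hz : z ∈ V) :
    (fun z' => v z' z') =ᶠ[𝓝 z] v z := by
  filter_upwards [hv z hz] with z' hz'
  rw [hz']

theorem contDiffAt_phase (hv : ∀ z ∈ V, ∀ᶠ z' in 𝓝 z, v z' = v z) {z : X} (hz : z ∈ V)
    {n : WithTop ℕ∞} : ContDiffAt ℝ n (fun z' => v z' z') z :=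
  (v z).contDiff.contDiffAt.congr_of_eventuallyEq (eventuallyEq_phase hv hz)

theorem hasFDerivAt_phase (hv : ∀ z ∈ V, ∀ᶠ z' in 𝓝 z, v z' = v z) {z : X} (hz : z ∈ V) :
    HasFDerivAt (fun z' => v z' z') (v z) z :=
  (v z).hasFDerivAt.congr_of_eventuallyEq (eventuallyEq_phase hv hz)

theorem continuousOn_cos_phase (hv : ∀ z ∈ V, ∀ᶠ z' in 𝓝 z, v z' = v z) (N : ℝ) :
    ContinuousOn (fun z => Real.cos (N * v z z)) V := fun _ hz =>
  (Real.continuous_cos.continuousAt.comp (continuousAt_const.mul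
    (contDiffAt_phase hv hz (n := 1)).continuousAt)).continuousWithinAt

theorem continuousOn_sin_phase (hv : ∀ z ∈ V, ∀ᶠ z' in 𝓝 z, v z' = v z) (N : ℝ) :
    ContinuousOn (fun z => Real.sin (N * v z z)) V := fun _ hz =>
  (Real.continuous_sin.continuousAt.comp (continuousAt_const.mul
    (contDiffAt_phase hv hz (n := 1)).continuousAt)).continuousWithinAt

theorem support_wave_subset (N : ℝ) : Function.support (wave b v N) ⊆ Function.support b := by
  intro z hz hb
  exact hz (by simp [wave, hb])

theorem tsupport_wave_subset (N : ℝ) : tsupport (wave b v N) ⊆ tsupport b :=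
  closure_mono (support_wave_subset N)

theorem contDiff_wave (hv : ∀ z ∈ V, ∀ᶠ z' in 𝓝 z, v z' = v z) {n : WithTop ℕ∞}
    (hb : ContDiff ℝ n b) (hbV : tsupport b ⊆ V) (N : ℝ) : ContDiff ℝ n (wave b v N) := by
  refine contDiff_of_contDiffAt_tsupport fun z hz => ?_
  have hz := hbV (tsupport_wave_subset N hz)
  exact (hb.contDiffAt.mul (contDiffAt_const.mul (contDiffAt_phase hv hz)).sin).div_const _

theorem fderiv_wave (hv : ∀ z ∈ V, ∀ᶠ z' in 𝓝 z, v z' = v z)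
    (hb : ContDiff ℝ 1 b) (hbV : tsupport b ⊆ V) {N : ℝ} (hN : N ≠ 0) (z : X) :
    fderiv ℝ (wave b v N) z =
      (b z * Real.cos (N * v z z)) • v z + (Real.sin (N * v z z) / N) • fderiv ℝ b z := by
  by_cases hz : z ∈ tsupport b
  · have h1 := ((hasFDerivAt_phase hv (hbV hz)).const_mul N).sin
    have h2 := ((hb.differentiable one_ne_zero z).hasFDerivAt.mul h1).mul_const N⁻¹
    have h3 : wave b v N = fun z => b z * Real.sin (N * v z z) * N⁻¹ := by
      ext z; rw [wave, div_eq_mul_inv]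
    have h4 : HasFDerivAt (fun z => b z * Real.sin (N * v z z) * N⁻¹) _ z := h2
    rw [h3, h4.fderiv]
    ext e
    simp
    field_simp
  · have h1 : fderiv ℝ (wave b v N) z = 0 := by
      refine image_eq_zero_of_notMem_tsupport fun h => hz ?_
      exact tsupport_wave_subset N (tsupport_fderiv_subset ℝ h)
    have h2 : fderiv ℝ b z = 0 :=
      image_eq_zero_of_notMem_tsupport fun h => hz (tsupport_fderiv_subset ℝ h)
    rw [h1, h2, image_eq_zero_of_notMem_tsupport hz]; simp

variable [FiniteDimensional ℝ X] [MeasurableSpace X] [BorelSpace X]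
  (μ : Measure X) [μ.IsAddHaarMeasure]

/-- A Riemann–Lebesgue lemma with locally constant wave covector, obtained by integrating the
derivative of a wave by parts. -/
theorem tendsto_integral_mul_cos (hv : ∀ z ∈ V, ∀ᶠ z' in 𝓝 z, v z' = v z)
    {e : X} {q : ℝ} (hq : q ≠ 0) (hve : ∀ z ∈ V, v z e = q) {f : X → ℝ} (hf : ContDiff ℝ 1 f)
    (hfc : HasCompactSupport f) (hfV : tsupport f ⊆ V) :
    Tendsto (fun N : ℕ => ∫ z, f z * Real.cos (N * v z z) ∂μ) atTop (𝓝 0) := by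
  set C := ∫ z, |fderiv ℝ f z e| ∂μ
  have hint : Integrable (fun z => fderiv ℝ f z e) μ :=
    ((hf.continuous_fderiv one_ne_zero).clm_apply continuous_const).integrable_of_hasCompactSupport
      (hfc.fderiv_apply ℝ e)
  refine squeeze_zero_norm' (a := fun N : ℕ => C / |q| * (1 / (N : ℝ))) ?_ ?_
  · filter_upwards [eventually_gt_atTop 0] with N hN
    have hN' : (0 : ℝ) < N := by exact_mod_cast hN
    have h0 := integral_fderiv_apply_eq_zero μ (contDiff_wave hv hf hfV N)
      (hfc.mono (support_wave_subset _)) e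
    have h1 : ∀ z, fderiv ℝ (wave f v N) z e =
        q * (f z * Real.cos (N * v z z)) + (Real.sin (N * v z z) / N) * fderiv ℝ f z e := by
      intro z
      rw [fderiv_wave hv hf hfV hN'.ne']
      by_cases hz : z ∈ V
      · simp [hve z hz]; ring
      · simp [image_eq_zero_of_notMem_tsupport fun h => hz (hfV h)]
    have hK : IsCompact (tsupport f) := hfc
    have i1 : Integrable (fun z => q * (f z * Real.cos (N * v z z))) μ := by
      refine integrable_of_support_subset_isCompact hK ?_ ?_
      · exact continuousOn_const.mul (hf.continuous.continuousOn.mul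
          ((continuousOn_cos_phase hv N).mono hfV))
      · intro z hz; by_contra h
        exact hz (by simp [image_eq_zero_of_notMem_tsupport h])
    have i2 : Integrable (fun z => (Real.sin (N * v z z) / N) * fderiv ℝ f z e) μ := by
      refine integrable_of_support_subset_isCompact hK ?_ ?_
      · have := ((hf.continuous_fderiv one_ne_zero).clm_apply
          (continuous_const (y := e))).continuousOn (s := tsupport f)
        exact (((continuousOn_sin_phase hv N).mono hfV).div_const _).mul this
      · intro z hz; by_contra h
        have : fderiv ℝ f z = 0 :=
          image_eq_zero_of_notMem_tsupport fun h' => h (tsupport_fderiv_subset ℝ h')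
        exact hz (by simp [this])
    simp_rw [h1] at h0
    rw [integral_add i1 i2, integral_const_mul] at h0
    have h2 : |∫ z, (Real.sin (N * v z z) / N) * fderiv ℝ f z e ∂μ| ≤ C * (1 / N) := by
      rw [← integral_mul_const, ← Real.norm_eq_abs]
      refine norm_integral_le_of_norm_le (hint.abs.mul_const _) (Eventually.of_forall fun z => ?_)
      rw [Real.norm_eq_abs, abs_mul, abs_div, abs_of_pos hN', mul_comm, div_eq_mul_one_div]
      have := Real.abs_sin_le_one (N * v z z)
      have h4 : 0 ≤ 1 / (N : ℝ) := by positivity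
      exact mul_le_mul_of_nonneg_left (by nlinarith) (abs_nonneg _)
    rw [Real.norm_eq_abs]
    have h3 : |q| * |∫ z, f z * Real.cos (N * v z z) ∂μ| ≤ C * (1 / N) := by
      rw [← abs_mul, eq_neg_of_add_eq_zero_left h0, abs_neg]; exact h2
    rw [div_mul_eq_mul_div, le_div_iff₀ (abs_pos.2 hq)]
    linarith
  · simpa using tendsto_one_div_atTop_nhds_zero_nat.const_mul (C / |q|)

/-- Adding a wave of high frequency to a function raises the weighted second moment of its
derivative `x` in the direction `e` by half the mean square of the amplitude. -/
theorem tendsto_secondMoment_wave (hv : ∀ z ∈ V, ∀ᶠ z' in 𝓝 z, v z' = v z) (hV : IsOpen V)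
    {e : X} {q : ℝ} (hq : q ≠ 0) (hve : ∀ z ∈ V, v z e = q)
    (hb : ContDiff ℝ 1 b) (hbc : HasCompactSupport b) (hbV : tsupport b ⊆ V)
    {ω : X → ℝ} (hω : ContDiff ℝ 1 ω) {x : X → ℝ} (hx : ContDiffOn ℝ 1 x V) :
    Tendsto (fun N : ℕ => ∫ z, ω z * ((x z + fderiv ℝ (wave b v N) z e) ^ 2 - x z ^ 2) ∂μ) atTop
      (𝓝 (q ^ 2 / 2 * ∫ z, ω z * b z ^ 2 ∂μ)) := by
  have hK : IsCompact (tsupport b) := hbc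
  set f₁ : X → ℝ := fun z => b z * (2 * q * ω z * x z) with hf₁
  set f₂ : X → ℝ := fun z => b z * (q ^ 2 / 2 * ω z * b z) with hf₂
  set d : X → ℝ := fun z => fderiv ℝ b z e with hd
  have hdcont : Continuous d := (hb.continuous_fderiv one_ne_zero).clm_apply continuous_const
  have hd0 : ∀ z ∉ tsupport b, d z = 0 := fun z hz => by
    have : fderiv ℝ b z = 0 :=
      image_eq_zero_of_notMem_tsupport fun h' => hz (tsupport_fderiv_subset ℝ h')
    simp [hd, this]
  have hxc : ContinuousOn x (tsupport b) := hx.continuousOn.mono hbV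
  have hωc := hω.continuous
  have hbcont := hb.continuous
  have s₁ : tsupport f₁ ⊆ tsupport b := tsupport_mul_subset_left
  have s₂ : tsupport f₂ ⊆ tsupport b := tsupport_mul_subset_left
  have c₁ : ContDiff ℝ 1 f₁ := contDiff_of_contDiffAt_tsupport fun z hz =>
    hb.contDiffAt.mul ((contDiffAt_const.mul hω.contDiffAt).mul
      (hx.contDiffAt (hV.mem_nhds (hbV (s₁ hz)))))
  have c₂ : ContDiff ℝ 1 f₂ := hb.mul ((contDiff_const.mul hω).mul hb)
  have t₁ := tendsto_integral_mul_cos μ hv hq hve c₁ (hbc.of_isClosed_subset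
    (isClosed_tsupport _) s₁) (s₁.trans hbV)
  have t₂ := (tendsto_integral_mul_cos μ hv hq hve c₂ (hbc.of_isClosed_subset
    (isClosed_tsupport _) s₂) (s₂.trans hbV)).comp
      (tendsto_id.const_mul_atTop' (zero_lt_two' ℕ))
  set R : X → ℝ := fun z => |ω z * d z| * (2 * |x z| + 2 * |q| * |b z| + |d z|) with hR
  have iR : Integrable R μ := by
    refine integrable_of_support_subset_isCompact hK ?_ fun z hz => ?_
    · have := hdcont.continuousOn (s := tsupport b)
      have h3 := hωc.continuousOn (s := tsupport b)
      have h4 := hbcont.continuousOn (s := tsupport b)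
      exact (h3.mul this).abs.mul (((continuousOn_const.mul hxc.abs).add
        (continuousOn_const.mul h4.abs)).add this.abs)
    · by_contra h; exact hz (by simp [hR, hd0 z h])
  have i₀ : Integrable (fun z => q ^ 2 / 2 * (ω z * b z ^ 2)) μ := by
    refine integrable_of_support_subset_isCompact hK (by fun_prop) fun z hz => ?_
    by_contra h; exact hz (by simp [image_eq_zero_of_notMem_tsupport h])
  -- the terms of order `1 / N`, due to the derivative of the amplitude
  set r : ℕ → X → ℝ := fun N z =>
    ω z * (Real.sin (N * v z z) * d z) * (2 * x z + 2 * q * b z * Real.cos (N * v z z)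
      + Real.sin (N * v z z) * d z / N) with hr
  have ir : ∀ N, Integrable (r N) μ := by
    intro N
    refine integrable_of_support_subset_isCompact hK ?_ fun z hz => ?_
    · have h1 := (continuousOn_sin_phase hv N).mono hbV
      have h2 := (continuousOn_cos_phase hv N).mono hbV
      exact (hωc.continuousOn.mul (h1.mul hdcont.continuousOn)).mul
        (((continuousOn_const.mul hxc).add ((continuousOn_const.mul hbcont.continuousOn).mul h2)).add
        ((h1.mul hdcont.continuousOn).div_const _))
    · by_contra h; exact hz (by simp [hr, hd0 z h])
  have i₁ : ∀ N : ℕ, Integrable (fun z => f₁ z * Real.cos (N * v z z)) μ := by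
    intro N
    refine integrable_of_support_subset_isCompact hK ?_ fun z hz => ?_
    · have h2 := (continuousOn_cos_phase hv N).mono hbV
      exact c₁.continuous.continuousOn.mul h2
    · by_contra h; exact hz (by simp [hf₁, image_eq_zero_of_notMem_tsupport h])
  have i₂ : ∀ N : ℕ, Integrable (fun z => f₂ z * Real.cos (N * v z z)) μ := by
    intro N
    refine integrable_of_support_subset_isCompact hK ?_ fun z hz => ?_
    · have h2 := (continuousOn_cos_phase hv N).mono hbV
      exact c₂.continuous.continuousOn.mul h2
    · by_contra h; exact hz (by simp [hf₂, image_eq_zero_of_notMem_tsupport h])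
  have tr : Tendsto (fun N : ℕ => (1 / (N : ℝ)) * ∫ z, r N z ∂μ) atTop (𝓝 0) := by
    refine squeeze_zero_norm' (a := fun N : ℕ => 1 / (N : ℝ) * ∫ z, R z ∂μ) ?_
      (by simpa using tendsto_one_div_atTop_nhds_zero_nat.mul_const (∫ z, R z ∂μ))
    filter_upwards [eventually_ge_atTop 1] with N hN
    have hN' : (1 : ℝ) ≤ N := by exact_mod_cast hN
    rw [norm_mul, Real.norm_of_nonneg (by positivity)]
    refine mul_le_mul_of_nonneg_left (norm_integral_le_of_norm_le iR
      (Eventually.of_forall fun z => ?_)) (by positivity)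
    have hs := Real.abs_sin_le_one (N * v z z)
    have hc := Real.abs_cos_le_one (N * v z z)
    simp only [hr, hR, Real.norm_eq_abs, abs_mul]
    have h1 : |ω z| * (|Real.sin (N * v z z)| * |d z|) ≤ |ω z| * |d z| :=
      mul_le_mul_of_nonneg_left (mul_le_of_le_one_left (abs_nonneg _) hs) (abs_nonneg _)
    refine mul_le_mul h1 ?_ (abs_nonneg _) (by positivity)
    refine (abs_add_three _ _ _).trans ?_
    simp only [abs_mul, abs_div, abs_two]
    refine add_le_add (add_le_add le_rfl (mul_le_of_le_one_right (by positivity) hc)) ?_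
    · rw [abs_of_pos (show (0 : ℝ) < N by linarith)]
      exact (div_le_self (by positivity) hN').trans (mul_le_of_le_one_left (abs_nonneg _) hs)
  have key : ∀ᶠ N : ℕ in atTop,
      q ^ 2 / 2 * (∫ z, ω z * b z ^ 2 ∂μ) + (∫ z, f₁ z * Real.cos (N * v z z) ∂μ)
        + (∫ z, f₂ z * Real.cos ((2 * N : ℕ) * v z z) ∂μ) + (1 / (N : ℝ)) * ∫ z, r N z ∂μ =
      ∫ z, ω z * ((x z + fderiv ℝ (wave b v N) z e) ^ 2 - x z ^ 2) ∂μ := by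
    filter_upwards [eventually_gt_atTop 0] with N hN
    have hN' : (N : ℝ) ≠ 0 := by exact_mod_cast hN.ne'
    have hfun : (fun z => ω z * ((x z + fderiv ℝ (wave b v N) z e) ^ 2 - x z ^ 2)) =
        fun z => q ^ 2 / 2 * (ω z * b z ^ 2) + f₁ z * Real.cos (N * v z z) +
          f₂ z * Real.cos ((2 * N : ℕ) * v z z) + 1 / (N : ℝ) * r N z := by
      ext z
      rw [fderiv_wave hv hb hbV hN']
      by_cases hz : z ∈ tsupport b
      · have hcos : Real.cos ((2 * N : ℕ) * v z z) = 2 * Real.cos (N * v z z) ^ 2 - 1 := by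
          rw [← Real.cos_two_mul]; congr 1; push_cast; ring
        simp only [hf₁, hf₂, hr, hcos, hd, add_apply, smul_apply,
          smul_eq_mul, hve z (hbV hz)]
        field_simp
        ring
      · have h1 := hd0 z hz
        have h2 := image_eq_zero_of_notMem_tsupport hz
        simp only [hd] at h1
        simp [hf₁, hf₂, hr, h1, h2, hd]
    have i₀₁ : Integrable (fun z => q ^ 2 / 2 * (ω z * b z ^ 2) + f₁ z * Real.cos (N * v z z)) μ :=
      i₀.add (i₁ N)
    have i₀₁₂ : Integrable (fun z => q ^ 2 / 2 * (ω z * b z ^ 2) + f₁ z * Real.cos (N * v z z) +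
        f₂ z * Real.cos ((2 * N : ℕ) * v z z)) μ := i₀₁.add (i₂ (2 * N))
    rw [hfun, integral_add i₀₁₂ ((ir N).const_mul _), integral_add i₀₁ (i₂ (2 * N)),
      integral_add i₀ (i₁ N), integral_const_mul,
      integral_const_mul]
  simpa using ((((tendsto_const_nhds (x := q ^ 2 / 2 * ∫ z, ω z * b z ^ 2 ∂μ)).add t₁).add t₂).add
    tr).congr' key

end Oscillation

/-! ### Cutoffs and the oscillation step -/

theorem exists_compact_exhaustion {X : Type*} [NormedAddCommGroup X] [ProperSpace X] {V : Set X}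
    (hV : IsOpen V) : ∃ K : ℕ → Set X, (∀ n, IsCompact (K n)) ∧ (∀ n, K n ⊆ interior (K (n + 1))) ∧
      (∀ n, K n ⊆ Metric.closedBall 0 n) ∧ ⋃ n, K n = V := by
  have hcont : Continuous fun z : X => Metric.infEDist z Vᶜ := Metric.continuous_infEDist
  refine ⟨fun n => Metric.closedBall 0 n ∩ {z | ((n : ℝ≥0∞) + 1)⁻¹ ≤ Metric.infEDist z Vᶜ},
    fun n => ?_, fun n => ?_, fun n => inter_subset_left, ?_⟩
  · exact (isCompact_closedBall _ _).inter_right (isClosed_le continuous_const hcont)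
  · have ho : IsOpen (Metric.ball (0 : X) (n + 1 : ℕ) ∩
        {z | (((n + 1 : ℕ) : ℝ≥0∞) + 1)⁻¹ < Metric.infEDist z Vᶜ}) :=
      Metric.isOpen_ball.inter (isOpen_lt continuous_const hcont)
    refine Subset.trans ?_ (interior_maximal ?_ ho)
    swap
    · exact inter_subset_inter Metric.ball_subset_closedBall fun z hz => by
        simp only [mem_ofPred_eq] at hz ⊢; exact hz.le
    refine inter_subset_inter (Metric.closedBall_subset_ball (by push_cast; linarith)) fun z hz => ?_
    refine lt_of_lt_of_le (ENNReal.inv_lt_inv.2 ?_) hz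
    push_cast
    exact ENNReal.lt_add_right (by finiteness) one_ne_zero
  · refine Subset.antisymm (iUnion_subset fun n z hz => ?_) fun z hz => ?_
    · by_contra h
      have := hz.2
      rw [mem_ofPred_eq, Metric.infEDist_zero_of_mem (show z ∈ Vᶜ from h)] at this
      simp at this
    · have hpos : 0 < Metric.infEDist z Vᶜ := by
        rw [pos_iff_ne_zero, Ne, ← Metric.mem_closure_iff_infEDist_zero,
          hV.isClosed_compl.closure_eq]
        exact fun h => h hz
      obtain ⟨n, hn⟩ := ENNReal.exists_inv_nat_lt hpos.ne'
      obtain ⟨m, hm⟩ := exists_nat_ge ‖z‖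
      refine mem_iUnion.2 ⟨max n m, ?_, ?_⟩
      · rw [mem_closedBall_zero_iff]
        exact hm.trans (by exact_mod_cast le_max_right n m)
      · refine le_trans ?_ hn.le
        refine ENNReal.inv_le_inv.2 (le_trans ?_ le_self_add)
        exact_mod_cast le_max_left n m

theorem monotone_of_subset_interior_succ {X : Type*} [TopologicalSpace X] {K : ℕ → Set X}
    (hK : ∀ n, K n ⊆ interior (K (n + 1))) : Monotone K :=
  monotone_nat_of_le_succ fun n => (hK n).trans interior_subset

/-- A `C²` cutoff function that is `1` near `K` and is supported in `L`. -/
theorem exists_cutoff {X : Type*} [NormedAddCommGroup X] [NormedSpace ℝ X]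
    [FiniteDimensional ℝ X] {K L : Set X} (hK : IsCompact K) (hL : IsCompact L)
    (hKL : K ⊆ interior L) :
    ∃ ψ : X → ℝ, ContDiff ℝ 2 ψ ∧ HasCompactSupport ψ ∧ tsupport ψ ⊆ L ∧
      (∀ᶠ z in 𝓝ˢ K, ψ z = 1) ∧ ∀ z, ψ z ∈ Icc (0 : ℝ) 1 := by
  have := FiniteDimensional.proper ℝ X
  obtain ⟨f, hf1, hf0, hf⟩ := exists_contMDiffMap_one_nhds_of_subset_interior
    (modelWithCornersSelf ℝ X) hK.isClosed hKL (n := 2)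
  have hs : tsupport f ⊆ L := closure_minimal
    (fun z hz => by_contra fun h => hz (hf0 z h)) hL.isClosed
  exact ⟨f, f.contMDiff.contDiff, hL.of_isClosed_subset (isClosed_tsupport _) hs, hs, hf1, hf⟩

section

variable {X : Type*} [NormedAddCommGroup X] [NormedSpace ℝ X] [FiniteDimensional ℝ X]
  [MeasurableSpace X] [BorelSpace X] (μ : Measure X)

theorem exists_compact_setIntegral_diff_le {V : Set X} (hV : IsOpen V) {ω : X → ℝ}
    (hω : Integrable ω μ) {η : ℝ} (hη : 0 < η) :
    ∃ K L : Set X, IsCompact K ∧ IsCompact L ∧ K ⊆ interior L ∧ L ⊆ V ∧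
      ∫ z in V \ K, ω z ∂μ ≤ η := by
  have := FiniteDimensional.proper ℝ X
  obtain ⟨K, hK, hKK, -, rfl⟩ := exists_compact_exhaustion hV
  have ht := tendsto_setIntegral_of_monotone (μ := μ) (f := ω)
    (fun n => (hK n).isClosed.measurableSet) (monotone_of_subset_interior_succ hKK)
    hω.integrableOn
  obtain ⟨n, hn⟩ := (ht.eventually (lt_mem_nhds (sub_lt_self _ hη))).exists
  refine ⟨K n, K (n + 1), hK n, hK _, hKK n, subset_iUnion _ _, ?_⟩
  have := setIntegral_sdiff (hK n).isClosed.measurableSet hω.integrableOn (subset_iUnion K n)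
  linarith

/-- One step of the construction: on an open set `V` with locally constant directions `v` and
amplitudes `A`, there is a small smooth function supported in `V` whose derivative lies
nearly on the segments `[-A v, A v]` and which raises the weighted second moment of `x`, a
derivative in the direction `e`, by nearly the largest possible amount. -/
theorem exists_oscillation [μ.IsAddHaarMeasure] {V : Set X} (hV : IsOpen V)
    {v : X → X →L[ℝ] ℝ} (hv : ∀ z ∈ V, ∀ᶠ z' in 𝓝 z, v z' = v z)
    {e : X} {q : ℝ} (hq : q ≠ 0) (hve : ∀ z ∈ V, v z e = q)
    {A : X → ℝ} (hA : ∀ z ∈ V, ∀ᶠ z' in 𝓝 z, A z' = A z) {α : ℝ} (hα : ∀ z, |A z| ≤ α)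
    {ω : X → ℝ} (hω : ContDiff ℝ 1 ω) (hω0 : ∀ z, 0 ≤ ω z) (hωi : Integrable ω μ)
    {x : X → ℝ} (hx : ContDiffOn ℝ 1 x V) {η : ℝ} (hη : 0 < η) :
    ∃ g : X → ℝ, ContDiff ℝ 2 g ∧ tsupport g ⊆ V ∧ (∀ z, |g z| ≤ η) ∧
      (∀ z, ∃ t : ℝ, |t| ≤ |A z| ∧ ‖fderiv ℝ g z - t • v z‖ ≤ η) ∧
      (∀ z ∈ V, A z = 0 → fderiv ℝ g z = 0) ∧
      q ^ 2 / 2 * (∫ z in V, ω z * A z ^ 2 ∂μ) - η ≤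
        ∫ z, ω z * ((x z + fderiv ℝ g z e) ^ 2 - x z ^ 2) ∂μ := by
  have hα0 : 0 ≤ α := (abs_nonneg _).trans (hα 0)
  set η' := η / 2 / (q ^ 2 / 2 * α ^ 2 + 1) with hη'
  have hη'0 : 0 < η' := by positivity
  obtain ⟨K, L, hK, hL, hKL, hLV, hint⟩ := exists_compact_setIntegral_diff_le μ hV hωi hη'0
  obtain ⟨ψ, hψ, hψc, hψL, hψ1, hψI⟩ := exists_cutoff hK hL hKL
  set b : X → ℝ := fun z => ψ z * A z with hb
  have hsb : tsupport b ⊆ tsupport ψ := tsupport_mul_subset_left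
  have hbV : tsupport b ⊆ V := hsb.trans (hψL.trans hLV)
  have hbc : HasCompactSupport b := hψc.mul_right
  have hAn : ∀ z ∈ V, ∀ n : WithTop ℕ∞, ContDiffAt ℝ n A z := fun z hz n =>
    contDiffAt_const.congr_of_eventuallyEq (hA z hz)
  have hbd : ContDiff ℝ 2 b := contDiff_of_contDiffAt_tsupport fun z hz =>
    hψ.contDiffAt.mul (hAn z (hbV hz) 2)
  have hbd1 : ContDiff ℝ 1 b := hbd.of_le one_le_two
  have hbA : ∀ z, |b z| ≤ |A z| := fun z => by
    simp only [hb, abs_mul, abs_of_nonneg (hψI z).1]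
    exact mul_le_of_le_one_left (abs_nonneg _) (hψI z).2
  obtain ⟨B, hB⟩ := (hbd1.continuous_fderiv one_ne_zero).bounded_above_of_compact_support
    (hbc.fderiv ℝ)
  have hAV : IntegrableOn (fun z => ω z * A z ^ 2) V μ := by
    refine (hωi.integrableOn (s := V)).mul_bdd (c := α ^ 2) ?_ (Eventually.of_forall fun z => ?_)
    · exact (ContinuousOn.pow (fun z hz => (hAn z hz 0).continuousAt.continuousWithinAt)
        2).aestronglyMeasurable hV.measurableSet
    · rw [norm_pow]
      exact pow_le_pow_left₀ (norm_nonneg _) (hα z) 2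
  -- the cutoff loses little mass
  have hmass : (∫ z in V, ω z * A z ^ 2 ∂μ) - α ^ 2 * η' ≤ ∫ z, ω z * b z ^ 2 ∂μ := by
    have hKm := hK.isClosed.measurableSet
    have hKV : K ⊆ V := hKL.trans (interior_subset.trans hLV)
    have h1 := setIntegral_sdiff hKm hAV hKV
    have h2 : ∫ z in V \ K, ω z * A z ^ 2 ∂μ ≤ α ^ 2 * η' := by
      calc ∫ z in V \ K, ω z * A z ^ 2 ∂μ ≤ ∫ z in V \ K, α ^ 2 * ω z ∂μ := by
            refine integral_mono (hAV.mono_set sdiff_subset) (hωi.integrableOn.const_mul _) fun z => ?_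
            have := sq_le_sq' (by linarith [neg_abs_le (A z), hα z]) ((le_abs_self _).trans (hα z))
            show ω z * A z ^ 2 ≤ α ^ 2 * ω z
            nlinarith [hω0 z]
        _ = α ^ 2 * ∫ z in V \ K, ω z ∂μ := integral_const_mul _ _
        _ ≤ _ := by gcongr
    have hbi : Integrable (fun z => ω z * b z ^ 2) μ := by
      refine integrable_of_support_subset_isCompact hbc
        (hω.continuous.mul (hbd.continuous.pow 2)).continuousOn fun z hz => ?_
      by_contra h; exact hz (by simp [image_eq_zero_of_notMem_tsupport h])
    have h3 : ∫ z in K, ω z * A z ^ 2 ∂μ ≤ ∫ z, ω z * b z ^ 2 ∂μ := by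
      calc ∫ z in K, ω z * A z ^ 2 ∂μ = ∫ z in K, ω z * b z ^ 2 ∂μ := by
            refine setIntegral_congr_fun hKm fun z hz => ?_
            have : ψ z = 1 := hψ1.self_of_nhdsSet z hz
            simp [hb, this]
        _ ≤ _ := setIntegral_le_integral hbi (Eventually.of_forall fun z =>
            mul_nonneg (hω0 z) (sq_nonneg _))
    linarith
  have hlim := tendsto_secondMoment_wave μ hv hV hq hve hbd1 hbc hbV hω hx
  have hlt : q ^ 2 / 2 * (∫ z in V, ω z * A z ^ 2 ∂μ) - η <
      q ^ 2 / 2 * ∫ z, ω z * b z ^ 2 ∂μ := by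
    have h1 : q ^ 2 / 2 * (α ^ 2 * η') ≤ η / 2 := by
      rw [← mul_assoc, hη', mul_div_assoc', div_le_iff₀ (by positivity)]
      nlinarith
    have h2 : 0 ≤ q ^ 2 / 2 := by positivity
    nlinarith [mul_le_mul_of_nonneg_left hmass h2]
  have hsmall : ∀ C : ℝ, ∀ᶠ N : ℕ in atTop, C / N < η := fun C =>
    (tendsto_const_div_atTop_nhds_zero_nat C).eventually (gt_mem_nhds hη)
  obtain ⟨N, hN0, hN1, hN2, hN3⟩ := ((eventually_gt_atTop 0).and ((hlim.eventually
    (lt_mem_nhds hlt)).and ((hsmall α).and (hsmall B)))).exists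
  have hN : (0 : ℝ) < N := by exact_mod_cast hN0
  refine ⟨wave b v N, contDiff_wave hv hbd hbV N,
    (tsupport_wave_subset _).trans hbV, fun z => ?_, fun z => ?_, fun z hz hAz => ?_, hN1.le⟩
  · refine le_trans ?_ hN2.le
    rw [wave, abs_div, abs_mul, abs_of_pos hN]
    gcongr
    exact (mul_le_of_le_one_right (abs_nonneg _) (Real.abs_sin_le_one _)).trans
      ((hbA z).trans (hα z))
  · refine ⟨b z * Real.cos (N * v z z), ?_, ?_⟩
    · rw [abs_mul]
      exact (mul_le_of_le_one_right (abs_nonneg _) (Real.abs_cos_le_one _)).trans (hbA z)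
    · rw [fderiv_wave hv hbd1 hbV hN.ne', add_sub_cancel_left, norm_smul, norm_div,
        Real.norm_of_nonneg hN.le, div_mul_eq_mul_div]
      refine le_trans ?_ hN3.le
      gcongr
      exact (mul_le_of_le_one_left (norm_nonneg _) (Real.abs_sin_le_one _)).trans (hB z)
  · have hb0 : b =ᶠ[𝓝 z] fun _ => 0 := by
      filter_upwards [hA z hz] with z' hz'
      simp [hb, hz', hAz]
    rw [fderiv_wave hv hbd1 hbV hN.ne', hb0.fderiv_eq, hb0.self_of_nhds]
    simp

end

/-! ### A smooth starting function -/

section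

variable {X : Type*} [NormedAddCommGroup X]

theorem exists_arctan_sub_eq {M s t : ℝ} (hs : |s| ≤ M) (ht : |t| ≤ M) :
    ∃ κ : ℝ, 1 / (1 + M ^ 2) ≤ κ ∧ κ ≤ 1 ∧ Real.arctan s - Real.arctan t = κ * (s - t) := by
  have hM : 0 ≤ M := (abs_nonneg s).trans hs
  wlog h : t < s generalizing s t
  · rcases (not_lt.1 h).eq_or_lt with rfl | h'
    · exact ⟨1, by rw [div_le_one (by positivity)]; nlinarith, le_rfl, by simp⟩
    · obtain ⟨κ, h1, h2, h3⟩ := this ht hs h'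
      exact ⟨κ, h1, h2, by linarith⟩
  obtain ⟨ξ, hξ, hd⟩ := exists_hasDerivAt_eq_slope Real.arctan (fun x => 1 / (1 + x ^ 2)) h
    Real.continuous_arctan.continuousOn fun x _ => Real.hasDerivAt_arctan x
  have h1 := abs_le.1 hs
  have h2 := abs_le.1 ht
  have h3 : ξ ^ 2 ≤ M ^ 2 := sq_le_sq' (by linarith [hξ.1]) (by linarith [hξ.2])
  refine ⟨1 / (1 + ξ ^ 2), by gcongr, ?_, ?_⟩
  · rw [div_le_one (by positivity)]; nlinarith
  · rw [hd, div_mul_cancel₀ _ (sub_pos.2 h).ne']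

/-- A `1`-Lipschitz function whose restriction to `S` has a Lipschitz constant less than `1` can
be perturbed, without changing it on `S`, so as to have Lipschitz constant less than `1` on every
ball. It is moved towards a Lipschitz extension of its restriction to `S`, by a bounded amount. -/
theorem exists_locally_strict_lipschitz {u E : X → ℝ} {L : ℝ≥0} (hu : LipschitzWith 1 u)
    (hE : LipschitzWith L E) (hL : L < 1) {ε : ℝ} (hε : 0 < ε) :
    ∃ u₁ : X → ℝ, (∀ z, E z = u z → u₁ z = u z) ∧ (∀ z, |u₁ z - u z| ≤ ε) ∧
      ∃ c : ℕ → ℝ, Antitone c ∧ (∀ n, 0 < c n) ∧ (∀ n, c n ≤ 1) ∧ ∀ n : ℕ, ∀ x ∈ Metric.ball (0 : X) n,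
        ∀ y ∈ Metric.ball (0 : X) n, |u₁ x - u₁ y| ≤ (1 - c n) * ‖x - y‖ := by
  set a := min 1 (ε / 2) with ha
  have ha0 : 0 < a := by positivity
  have ha1 : a ≤ 1 := min_le_left _ _
  have haε : a ≤ ε / 2 := min_le_right _ _
  have hL' : (L : ℝ) < 1 := by exact_mod_cast hL
  set f : X → ℝ := fun z => E z - u z with hf
  have hu' : ∀ x y, |u x - u y| ≤ ‖x - y‖ := fun x y => by
    simpa [Real.dist_eq, dist_eq_norm] using hu.dist_le_mul x y
  have hE' : ∀ x y, |E x - E y| ≤ L * ‖x - y‖ := fun x y => by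
    simpa [Real.dist_eq, dist_eq_norm] using hE.dist_le_mul x y
  set M : ℕ → ℝ := fun n => |f 0| + 2 * n with hM
  have hfM : ∀ n : ℕ, ∀ z ∈ Metric.ball (0 : X) n, |f z| ≤ M n := by
    intro n z hz
    have hz' : ‖z‖ < n := mem_ball_zero_iff.1 hz
    have h1 := hu' z 0
    have h2 := hE' z 0
    rw [sub_zero] at h1 h2
    have h3 : f z = f 0 + (E z - E 0) - (u z - u 0) := by simp only [hf]; ring
    have h4 : |f z| ≤ |f 0| + |E z - E 0| + |u z - u 0| := by
      rw [h3]; exact (abs_sub _ _).trans (by gcongr; exact abs_add_le _ _)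
    simp only [hM]
    nlinarith [norm_nonneg z]
  refine ⟨fun z => u z + a * Real.arctan (f z), fun z hz => by simp [hf, hz], fun z => ?_,
    fun n => (1 - L) * (a * (1 / (1 + M n ^ 2))), ?_, fun n => ?_, fun n => ?_,
    fun n x hx y hy => ?_⟩
  · rw [add_sub_cancel_left, abs_mul, abs_of_pos ha0]
    have h1 : |Real.arctan (f z)| ≤ 2 := abs_le.2
      ⟨by linarith [Real.neg_pi_div_two_lt_arctan (f z), Real.pi_lt_four],
        by linarith [Real.arctan_lt_pi_div_two (f z), Real.pi_lt_four]⟩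
    nlinarith
  · intro m n hmn
    have h1 : M m ≤ M n := by simp only [hM]; gcongr
    have h2 : 0 ≤ M m := by simp only [hM]; positivity
    have h3 : 0 ≤ 1 - (L : ℝ) := by linarith
    show (1 - (L : ℝ)) * (a * (1 / (1 + M n ^ 2))) ≤ (1 - L) * (a * (1 / (1 + M m ^ 2)))
    gcongr
  · have h3 : 0 < 1 - (L : ℝ) := by linarith
    positivity
  · have h1 : 1 / (1 + M n ^ 2) ≤ 1 := by
      rw [div_le_one (by positivity)]; nlinarith [sq_nonneg (M n)]
    have h2 : 0 ≤ 1 / (1 + M n ^ 2) := by positivity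
    have h3 : a * (1 / (1 + M n ^ 2)) ≤ 1 := by nlinarith
    have h4 : 0 ≤ a * (1 / (1 + M n ^ 2)) := by positivity
    have h5 : 0 ≤ (L : ℝ) := L.2
    show (1 - (L : ℝ)) * (a * (1 / (1 + M n ^ 2))) ≤ 1
    nlinarith
  · obtain ⟨κ, h1, h2, h3⟩ := exists_arctan_sub_eq (hfM n x hx) (hfM n y hy)
    have h4 : u x + a * Real.arctan (f x) - (u y + a * Real.arctan (f y)) =
        (1 - a * κ) * (u x - u y) + a * κ * (E x - E y) := by
      have h5 : u x + a * Real.arctan (f x) - (u y + a * Real.arctan (f y)) =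
        u x - u y + a * (Real.arctan (f x) - Real.arctan (f y)) := by ring
      rw [h5, h3]; simp only [hf]; ring
    have hκ0 : 0 < κ := lt_of_lt_of_le (by positivity) h1
    have h6 : 0 ≤ 1 - a * κ := by nlinarith
    show |u x + a * Real.arctan (f x) - (u y + a * Real.arctan (f y))| ≤ _
    rw [h4]
    refine (abs_add_le _ _).trans ?_
    rw [abs_mul (1 - a * κ), abs_mul (a * κ), abs_of_nonneg h6, abs_of_pos (mul_pos ha0 hκ0)]
    have h7 := mul_le_mul_of_nonneg_left (hu' x y) h6
    have h8 := mul_le_mul_of_nonneg_left (hE' x y) (mul_pos ha0 hκ0).le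
    have h9 : (1 - (L : ℝ)) * (a * (1 / (1 + M n ^ 2))) ≤ (1 - L) * (a * κ) := by
      have : 0 ≤ 1 - (L : ℝ) := by linarith
      gcongr
    have h10 := mul_le_mul_of_nonneg_right h9 (norm_nonneg (x - y))
    show _ ≤ (1 - (1 - (L : ℝ)) * (a * (1 / (1 + M n ^ 2)))) * ‖x - y‖
    nlinarith

variable [NormedSpace ℝ X] [FiniteDimensional ℝ X]

/-- Mollification at scale `r`, which does not increase local Lipschitz constants. -/
theorem exists_mollification {u : X → ℝ} (hu : LipschitzWith 1 u) {r : ℝ} (hr : 0 < r) :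
    ∃ f : X → ℝ, ContDiff ℝ 2 f ∧ (∀ z, |f z - u z| ≤ r) ∧
      ∀ (C R : ℝ), (∀ x ∈ Metric.ball (0 : X) R, ∀ y ∈ Metric.ball (0 : X) R,
        |u x - u y| ≤ C * ‖x - y‖) → ∀ x ∈ Metric.ball (0 : X) (R - r),
        ∀ y ∈ Metric.ball (0 : X) (R - r), |f x - f y| ≤ C * ‖x - y‖ := by
  borelize X
  set φ : ContDiffBump (0 : X) := ⟨r / 2, r, half_pos hr, half_lt_self hr⟩ with hφ
  set μ : Measure X := Measure.addHaar
  have huc := hu.continuous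
  have hint : ∀ x, Integrable (fun t => φ.normed μ t * u (x - t)) μ := fun x =>
    (φ.continuous_normed.mul (by fun_prop)).integrable_of_hasCompactSupport
      φ.hasCompactSupport_normed.mul_right
  set f : X → ℝ := convolution (φ.normed μ) u (ContinuousLinearMap.lsmul ℝ ℝ) μ with hf
  have hfe : ∀ x, f x = ∫ t, φ.normed μ t * u (x - t) ∂μ := fun x => rfl
  refine ⟨f, ?_, fun z => ?_, fun C R hC x hx y hy => ?_⟩
  · exact φ.hasCompactSupport_normed.contDiff_convolution_left _ φ.contDiff_normed
      huc.locallyIntegrable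
  · rw [← Real.dist_eq]
    refine φ.dist_normed_convolution_le huc.aestronglyMeasurable fun x hx => ?_
    have := hu.dist_le_mul x z
    simp only [NNReal.coe_one, one_mul] at this
    exact this.trans (Metric.mem_ball.1 hx).le
  · rw [hfe, hfe, ← integral_sub (hint x) (hint y), ← Real.norm_eq_abs]
    have h1 : ∫ t, φ.normed μ t * (C * ‖x - y‖) ∂μ = C * ‖x - y‖ := by
      rw [integral_mul_const, φ.integral_normed, one_mul]
    rw [← h1]
    refine norm_integral_le_of_norm_le
      (φ.integrable_normed.mul_const _) (Eventually.of_forall fun t => ?_)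
    rw [← mul_sub, norm_mul, Real.norm_of_nonneg (φ.nonneg_normed t), Real.norm_eq_abs]
    by_cases ht : φ.normed μ t = 0
    · simp [ht]
    · have ht' : ‖t‖ < r := by
        have : t ∈ Function.support (φ.normed μ) := ht
        rw [φ.support_normed_eq] at this
        exact mem_ball_zero_iff.1 this
      refine mul_le_mul_of_nonneg_left ?_ (φ.nonneg_normed t)
      have hxy : ∀ x ∈ Metric.ball (0 : X) (R - r), x - t ∈ Metric.ball (0 : X) R := fun x hx => by
        rw [mem_ball_zero_iff] at hx ⊢
        linarith [norm_sub_le x t]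
      simpa using hC _ (hxy x hx) _ (hxy y hy)

/-- Smoothing on an open set by mollification and a partition of unity, keeping the function on
the complement and the norm of the derivative below `1`. -/
theorem exists_smoothing {Ω : Set X} (hΩ : IsOpen Ω) {u : X → ℝ} {c : ℕ → ℝ} (hc : Antitone c)
    (hc0 : ∀ n, 0 < c n) (hc1 : ∀ n, c n ≤ 1) (hu : ∀ n : ℕ, ∀ x ∈ Metric.ball (0 : X) n,
        ∀ y ∈ Metric.ball (0 : X) n, |u x - u y| ≤ (1 - c n) * ‖x - y‖) {ε : ℝ} (hε : 0 < ε) :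
    ∃ w : X → ℝ, ContDiffOn ℝ 2 w Ω ∧ (∀ z ∈ Ω, ‖fderiv ℝ w z‖ < 1) ∧ Continuous w ∧
      (∀ z ∉ Ω, w z = u z) ∧ ∀ z, |w z - u z| ≤ ε := by
  have := FiniteDimensional.proper ℝ X
  have hu1 : LipschitzWith 1 u := by
    refine LipschitzWith.of_dist_le_mul fun x y => ?_
    obtain ⟨n, hn⟩ := exists_nat_gt (max ‖x‖ ‖y‖)
    have := hu n x (mem_ball_zero_iff.2 ((le_max_left _ _).trans_lt hn)) y
      (mem_ball_zero_iff.2 ((le_max_right _ _).trans_lt hn))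
    rw [Real.dist_eq, dist_eq_norm, NNReal.coe_one, one_mul]
    nlinarith [hc0 n, norm_nonneg (x - y)]
  obtain ⟨K, hK, hKK, hKb, hKΩ⟩ := exists_compact_exhaustion hΩ
  have hKmono := monotone_of_subset_interior_succ hKK
  choose ψ hψ hψc hψK hψ1 hψI using fun n => exists_cutoff (hK n) (hK (n + 1)) (hKK n)
  set Ψ : ℕ → X → ℝ := fun n => Nat.casesOn n (fun _ => 0) ψ with hΨ
  have hΨd : ∀ n, ContDiff ℝ 2 (Ψ n) := by
    rintro (_ | n)
    · exact contDiff_const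
    · exact hψ n
  have hΨK : ∀ n, ∀ z ∉ K n, Ψ n z = 0 := by
    rintro (_ | n) z hz
    · rfl
    · exact image_eq_zero_of_notMem_tsupport fun h => hz (hψK n h)
  have hΨ1 : ∀ n, ∀ z ∈ K n, Ψ (n + 1) z = 1 := fun n z hz => (hψ1 n).self_of_nhdsSet z hz
  have hΨI : ∀ n z, Ψ n z ∈ Icc (0 : ℝ) 1 := by
    rintro (_ | n) z
    · exact ⟨le_rfl, zero_le_one⟩
    · exact hψI n z
  -- the partition of unity of `Ω`; `Ψ 0 = 0` makes the sums telescope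
  set χ : ℕ → X → ℝ := fun n z => Ψ (n + 1) z - Ψ n z with hχ
  have hχd : ∀ n, ContDiff ℝ 2 (χ n) := fun n => (hΨd (n + 1)).sub (hΨd n)
  have hχ0 : ∀ n z, 0 ≤ χ n z := fun n z => by
    by_cases hz : z ∈ K n
    · simp only [hχ, hΨ1 n z hz]; linarith [(hΨI n z).2]
    · simp only [hχ, hΨK n z hz]; linarith [(hΨI (n + 1) z).1]
  have hχ1 : ∀ n z, χ n z ≤ 1 := fun n z => by
    simp only [hχ]; linarith [(hΨI (n + 1) z).2, (hΨI n z).1]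
  have hχK : ∀ n, Function.support (χ n) ⊆ K (n + 1) := fun n z hz => by
    by_contra h
    exact hz (by simp only [hχ, hΨK _ z h, hΨK n z fun h' => h (hKmono n.le_succ h'), sub_zero])
  have hχtK : ∀ n, tsupport (χ n) ⊆ K (n + 1) := fun n =>
    closure_minimal (hχK n) (hK _).isClosed
  have hχsum : ∀ m z, ∑ n ∈ Finset.range m, χ n z = Ψ m z := fun m z => by
    simp only [hχ]; rw [Finset.sum_range_sub (fun n => Ψ n z)]; simp [hΨ]
  have hB : ∀ n, ∃ B, ∀ z, ‖fderiv ℝ (χ n) z‖ ≤ B := fun n =>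
    ((hχd n).continuous_fderiv two_ne_zero).bounded_above_of_compact_support
      (HasCompactSupport.fderiv ℝ ((hK (n + 1)).of_isClosed_subset (isClosed_tsupport _) (hχtK n)))
  choose B hB using hB
  have hB0 : ∀ n, 0 ≤ B n := fun n => (norm_nonneg _).trans (hB n 0)
  set r : ℕ → ℝ := fun n =>
    min 1 (min (ε / 2 * (1 / 2) ^ n) (c (n + 3) / 4 * (1 / 2) ^ n / (B n + 1))) with hr
  have hr0 : ∀ n, 0 < r n := fun n => by
    have := hc0 (n + 3)
    have := hB0 n
    simp only [hr]; positivity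
  have hr1 : ∀ n, r n ≤ 1 := fun n => min_le_left _ _
  have hrε : ∀ n, r n ≤ ε / 2 * (1 / 2) ^ n := fun n => (min_le_right _ _).trans (min_le_left _ _)
  have hrB : ∀ n, r n * B n ≤ c (n + 3) / 4 * (1 / 2) ^ n := fun n => by
    have h1 : r n ≤ c (n + 3) / 4 * (1 / 2) ^ n / (B n + 1) :=
      (min_le_right _ _).trans (min_le_right _ _)
    rw [le_div_iff₀ (by linarith [hB0 n])] at h1
    linarith [hr0 n]
  choose f hfd hfu hfL using fun n => exists_mollification hu1 (hr0 n)
  have hgeom : HasSum (fun n : ℕ => ε / 2 * (1 / 2 : ℝ) ^ n) ε := by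
    have := hasSum_geometric_two.mul_left (ε / 2)
    rwa [div_mul_cancel₀ _ two_ne_zero] at this
  have hterm : ∀ n z, ‖χ n z * (f n z - u z)‖ ≤ ε / 2 * (1 / 2) ^ n := fun n z => by
    rw [norm_mul, Real.norm_of_nonneg (hχ0 n z), Real.norm_eq_abs]
    exact (mul_le_of_le_one_left (abs_nonneg _) (hχ1 n z)).trans ((hfu n z).trans (hrε n))
  set w : X → ℝ := fun z => u z + ∑' n, χ n z * (f n z - u z) with hw
  -- near a point of `Ω` only finitely many terms matter
  have hloc : ∀ z ∈ Ω, ∃ m, (∀ᶠ z' in 𝓝 z, ∑ n ∈ Finset.range m, χ n z' = 1) ∧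
      ∀ᶠ z' in 𝓝 z, w z' = ∑ n ∈ Finset.range m, χ n z' * f n z' := by
    intro z hz
    rw [← hKΩ] at hz
    obtain ⟨m, hm⟩ := mem_iUnion.1 hz
    have hnear : ∀ᶠ z' in 𝓝 z, z' ∈ K (m + 1) := mem_interior_iff_mem_nhds.1 (hKK m hm)
    have hone : ∀ z' ∈ K (m + 1), ∀ n, m + 1 ≤ n → Ψ (n + 1) z' = 1 := fun z' hz' n hn =>
      hΨ1 n z' (hKmono hn hz')
    refine ⟨m + 2, hnear.mono fun z' hz' => ?_, hnear.mono fun z' hz' => ?_⟩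
    · rw [hχsum]; exact hone z' hz' _ le_rfl
    · have h1 : ∑' n, χ n z' * (f n z' - u z') =
          ∑ n ∈ Finset.range (m + 2), χ n z' * (f n z' - u z') := by
        refine tsum_eq_sum fun n hn => ?_
        rw [Finset.mem_range, not_lt] at hn
        obtain ⟨k, rfl⟩ : ∃ k, n = k + 1 := ⟨n - 1, by omega⟩
        have : χ (k + 1) z' = 0 := by
          simp only [hχ]
          rw [hone z' hz' (k + 1) (by omega), hone z' hz' k (by omega), sub_self]
        rw [this, zero_mul]
      have h2 : ∑ n ∈ Finset.range (m + 2), χ n z' = 1 := by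
        rw [hχsum]; exact hone z' hz' _ le_rfl
      simp only [hw]
      rw [h1]
      simp_rw [mul_sub]
      rw [Finset.sum_sub_distrib, ← Finset.sum_mul, h2]; ring
  have hsumd : ∀ m, ContDiff ℝ 2 fun z => ∑ n ∈ Finset.range m, χ n z * f n z := fun m =>
    ContDiff.sum fun n _ => (hχd n).mul (hfd n)
  refine ⟨w, fun z hz => ?_, fun z hz => ?_, ?_, fun z hz => ?_, fun z => ?_⟩
  · obtain ⟨m, -, hm⟩ := hloc z hz
    exact ((hsumd m).contDiffAt.congr_of_eventuallyEq hm).contDiffWithinAt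
  · obtain ⟨m, hm1, hm⟩ := hloc z hz
    have hz' := hz
    rw [← hKΩ] at hz'
    have hex : ∃ n, z ∈ K (n + 1) := by
      obtain ⟨n, hn⟩ := mem_iUnion.1 hz'
      exact ⟨n, hKmono n.le_succ hn⟩
    -- the first term whose support may contain `z`; its bounds dominate those of all later ones
    classical
    set n₀ := Nat.find hex
    have hn₀ : z ∈ K (n₀ + 1) := Nat.find_spec hex
    set c' := c (n₀ + 3)
    have hc' : 0 < c' := hc0 _
    have hχdiff : ∀ n, DifferentiableAt ℝ (χ n) z := fun n =>
      (hχd n).differentiable two_ne_zero z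
    have hfdiff : ∀ n, DifferentiableAt ℝ (f n) z := fun n =>
      (hfd n).differentiable two_ne_zero z
    have hD : HasFDerivAt (fun z => ∑ n ∈ Finset.range m, χ n z * f n z)
        (∑ n ∈ Finset.range m, (χ n z • fderiv ℝ (f n) z + f n z • fderiv ℝ (χ n) z)) z :=
      HasFDerivAt.fun_sum fun n _ => (hχdiff n).hasFDerivAt.mul (hfdiff n).hasFDerivAt
    have hD0 : ∑ n ∈ Finset.range m, fderiv ℝ (χ n) z = 0 := by
      have h1 : HasFDerivAt (fun z => ∑ n ∈ Finset.range m, χ n z)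
          (∑ n ∈ Finset.range m, fderiv ℝ (χ n) z) z :=
        HasFDerivAt.fun_sum fun n _ => (hχdiff n).hasFDerivAt
      have h2 : HasFDerivAt (fun z => ∑ n ∈ Finset.range m, χ n z) (0 : X →L[ℝ] ℝ) z :=
        (hasFDerivAt_const (1 : ℝ) z).congr_of_eventuallyEq hm1
      exact h1.unique h2
    -- the derivatives of the partition of unity add up to zero, so `u z` may be subtracted
    have hDw : fderiv ℝ w z = ∑ n ∈ Finset.range m,
        (χ n z • fderiv ℝ (f n) z + (f n z - u z) • fderiv ℝ (χ n) z) := by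
      have h3 : ∑ n ∈ Finset.range m, u z • fderiv ℝ (χ n) z = 0 := by
        rw [← Finset.smul_sum, hD0, smul_zero]
      rw [(hD.congr_of_eventuallyEq hm).fderiv, ← sub_zero (∑ n ∈ Finset.range m, _), ← h3,
        ← Finset.sum_sub_distrib]
      refine Finset.sum_congr rfl fun n _ => ?_
      rw [sub_smul (f n z), add_sub_assoc]
    have hbound : ∀ n, ‖χ n z • fderiv ℝ (f n) z + (f n z - u z) • fderiv ℝ (χ n) z‖ ≤
        (1 - c') * χ n z + c' / 4 * (1 / 2) ^ n := by
      intro n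
      by_cases hzn : z ∈ K (n + 1)
      · have hle : n₀ ≤ n := Nat.find_min' hex hzn
        have hcn : c (n + 3) ≤ c' := hc (by omega)
        have h1 : ‖fderiv ℝ (f n) z‖ ≤ 1 - c' := by
          have hzb : z ∈ Metric.ball (0 : X) (n₀ + 2) := by
            have := mem_closedBall_zero_iff.1 (hKb _ hn₀)
            push_cast at this
            rw [mem_ball_zero_iff]; linarith
          have hL := hfL n (1 - c') (n₀ + 3 : ℕ) (hu (n₀ + 3))
          have hsub : Metric.ball (0 : X) (n₀ + 2) ⊆ Metric.ball 0 ((n₀ + 3 : ℕ) - r n) :=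
            Metric.ball_subset_ball (by push_cast; linarith [hr1 n])
          refine norm_fderiv_le_of_lip' ℝ (sub_nonneg.2 (hc1 _)) ?_
          filter_upwards [Metric.isOpen_ball.mem_nhds hzb] with x hx
          exact hL x (hsub hx) z (hsub hzb)
        refine (norm_add_le _ _).trans (add_le_add ?_ ?_)
        · rw [norm_smul, Real.norm_of_nonneg (hχ0 n z), mul_comm]
          exact mul_le_mul_of_nonneg_right h1 (hχ0 n z)
        · rw [norm_smul, Real.norm_eq_abs]
          calc |f n z - u z| * ‖fderiv ℝ (χ n) z‖ ≤ r n * B n :=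
                mul_le_mul (hfu n z) (hB n z) (norm_nonneg _) (hr0 n).le
            _ ≤ c (n + 3) / 4 * (1 / 2) ^ n := hrB n
            _ ≤ _ := by gcongr
      · have h1 : χ n z = 0 := by_contra fun h => hzn (hχK n h)
        have h2 : fderiv ℝ (χ n) z = 0 := image_eq_zero_of_notMem_tsupport fun h =>
          hzn (hχtK n (tsupport_fderiv_subset ℝ h))
        rw [h1, h2]
        simp only [zero_smul, smul_zero, add_zero, norm_zero, mul_zero, zero_add]
        positivity
    rw [hDw]
    have hgs : ∑ n ∈ Finset.range m, c' / 4 * (1 / 2 : ℝ) ^ n ≤ c' / 2 := by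
      have h1 := (hasSum_geometric_two.mul_left (c' / 4))
      have h2 := h1.summable.sum_le_tsum (Finset.range m) fun n _ => by positivity
      rw [h1.tsum_eq] at h2
      linarith
    calc _ ≤ ∑ n ∈ Finset.range m, ((1 - c') * χ n z + c' / 4 * (1 / 2) ^ n) :=
          norm_sum_le_of_le _ fun n _ => hbound n
      _ = (1 - c') * 1 + ∑ n ∈ Finset.range m, c' / 4 * (1 / 2) ^ n := by
          rw [Finset.sum_add_distrib, ← Finset.mul_sum, hm1.self_of_nhds]
      _ < 1 := by linarith
  · exact hu1.continuous.add (continuous_tsum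
      (fun n => (hχd n).continuous.mul ((hfd n).continuous.sub hu1.continuous))
      hgeom.summable hterm)
  · have h1 : ∀ n, χ n z = 0 := fun n => by_contra fun h =>
      hz (hKΩ ▸ mem_iUnion.2 ⟨n + 1, hχK n h⟩)
    simp [hw, h1]
  · simp only [hw]
    rw [add_sub_cancel_left, ← Real.norm_eq_abs]
    exact tsum_of_norm_bounded hgeom fun n => hterm n z

end

/-! ### A dual pair, uniform Taylor estimates, and a weight -/

section

variable {X : Type*} [NormedAddCommGroup X] [NormedSpace ℝ X] [FiniteDimensional ℝ X]

theorem exists_dual_pair (hdim : 2 ≤ Module.finrank ℝ X) :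
    ∃ (ξ ζ : X →L[ℝ] ℝ) (e₁ e₂ : X), ξ e₁ = 1 ∧ ζ e₁ = 0 ∧ ξ e₂ = 0 ∧ ζ e₂ = 1 := by
  set b := Module.finBasis ℝ X
  refine ⟨LinearMap.toContinuousLinearMap (b.coord ⟨0, by omega⟩),
    LinearMap.toContinuousLinearMap (b.coord ⟨1, by omega⟩), b ⟨0, by omega⟩, b ⟨1, by omega⟩, ?_⟩
  simp

/-- A uniform first-order Taylor estimate on a compact set. -/
theorem exists_uniform_taylor {X : Type*} [NormedAddCommGroup X] [NormedSpace ℝ X] {Ω K : Set X} (hΩ : IsOpen Ω) (hK : IsCompact K) (hKΩ : K ⊆ Ω)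
    {w : X → ℝ} (hw : ContDiffOn ℝ 2 w Ω) {η : ℝ} (hη : 0 < η) :
    ∃ δ > 0, ∀ z ∈ K, ∀ h : X, ‖h‖ ≤ δ → |w (z + h) - w z - fderiv ℝ w z h| ≤ η * ‖h‖ := by
  suffices H : ∃ δ > 0, ∀ z ∈ K, ∀ h : X, ‖h‖ ≤ δ →
      |w (z + h) - w z - fderiv ℝ w z h| ≤ η * ‖h‖ from H
  refine hK.induction_on (p := fun s => ∃ δ > 0, ∀ z ∈ s, ∀ h : X, ‖h‖ ≤ δ →
    |w (z + h) - w z - fderiv ℝ w z h| ≤ η * ‖h‖) ⟨1, one_pos, by simp⟩ ?_ ?_ ?_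
  · rintro s t hst ⟨δ, hδ, h⟩
    exact ⟨δ, hδ, fun z hz => h z (hst hz)⟩
  · rintro s t ⟨δ, hδ, h⟩ ⟨δ', hδ', h'⟩
    refine ⟨min δ δ', lt_min hδ hδ', fun z hz k hk => ?_⟩
    rcases hz with hz | hz
    · exact h z hz k (hk.trans (min_le_left _ _))
    · exact h' z hz k (hk.trans (min_le_right _ _))
  · intro z hz
    have hzΩ := hΩ.mem_nhds (hKΩ hz)
    have hcd := hw.contDiffAt hzΩ
    have hstrict := (hcd.hasStrictFDerivAt two_ne_zero).isLittleO.def (half_pos hη)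
    have hcont : ∀ᶠ y in 𝓝 z, ‖fderiv ℝ w y - fderiv ℝ w z‖ < η / 2 := by
      have h1 : ContinuousAt (fderiv ℝ w) z :=
        (hw.continuousOn_fderiv_of_isOpen hΩ one_le_two).continuousAt hzΩ
      simpa [dist_eq_norm] using Metric.tendsto_nhds.1 h1 (η / 2) (half_pos hη)
    obtain ⟨r, hr, hball⟩ := Metric.eventually_nhds_iff_ball.1 (hstrict.and (hcont.prod_inr_nhds z))
    refine ⟨Metric.ball z (r / 2), mem_nhdsWithin_of_mem_nhds (Metric.ball_mem_nhds z (half_pos hr)),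
      r / 4, by positivity, fun y hy k hk => ?_⟩
    have hy' := Metric.mem_ball.1 hy
    have hyk : dist (y + k) z < r := by
      have h1 := dist_triangle (y + k) y z
      have h2 : dist (y + k) y = ‖k‖ := by simp [dist_eq_norm]
      linarith
    have hmem : (y + k, y) ∈ Metric.ball (z, z) r := by
      rw [Metric.mem_ball, Prod.dist_eq]
      exact max_lt hyk (by show dist y z < r; linarith)
    obtain ⟨h1, h2⟩ := hball _ hmem
    simp only [add_sub_cancel_left, Real.norm_eq_abs] at h1 h2
    have h3 : |(fderiv ℝ w y - fderiv ℝ w z) k| ≤ η / 2 * ‖k‖ :=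
      ((fderiv ℝ w y - fderiv ℝ w z).le_opNorm k).trans (by gcongr)
    have h4 : w (y + k) - w y - fderiv ℝ w y k =
        (w (y + k) - w y - fderiv ℝ w z k) - (fderiv ℝ w y - fderiv ℝ w z) k := by
      rw [sub_apply]; ring
    rw [h4]
    refine (abs_sub _ _).trans ?_
    linarith

/-- A positive integrable weight makes second moments finite when `Ω` has infinite measure. -/
theorem exists_weight [MeasurableSpace X] [BorelSpace X] (μ : Measure X) [μ.IsAddHaarMeasure] :
    ∃ ω : X → ℝ, ContDiff ℝ 1 ω ∧ (∀ z, 0 < ω z) ∧ Integrable ω μ := by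
  set T := toEuclidean (E := X)
  set d : ℝ := Module.finrank ℝ (EuclideanSpace ℝ (Fin (Module.finrank ℝ X))) + 1
  have h1 : ∀ z : X, (1 : ℝ) + ‖T z‖ ^ 2 ≠ 0 := fun z => by positivity
  refine ⟨fun z => (1 + ‖T z‖ ^ 2) ^ (-d / 2), ?_, fun z => by positivity, ?_⟩
  · exact (contDiff_const.add (T.contDiff.norm_sq ℝ)).rpow_const_of_ne h1
  · have h2 : Integrable (fun y => (1 + ‖y‖ ^ 2) ^ (-d / 2)) (μ.map T) :=
      integrable_rpow_neg_one_add_norm_sq (by simp only [d]; linarith)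
    exact (integrable_map_equiv T.toHomeomorph.toMeasurableEquiv _).1 h2

end

/-! ### The stages of the construction -/

/-- The distance `κ n` from the unit sphere within which derivatives are left alone at the `n`-th
stage. It tends to `0`, but its square is not summable. -/
noncomputable def rate (n : ℕ) : ℝ := 1 / (2 * √((n : ℝ) + 1))

theorem rate_pos (n : ℕ) : 0 < rate n := by unfold rate; positivity

theorem rate_le_half (n : ℕ) : rate n ≤ 1 / 2 := by
  unfold rate
  have : 1 ≤ √((n : ℝ) + 1) := Real.one_le_sqrt.2 (by linarith [n.cast_nonneg (α := ℝ)])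
  exact one_div_le_one_div_of_le two_pos (by linarith)

theorem rate_sq (n : ℕ) : rate n ^ 2 = 1 / 4 * (1 / ((n : ℝ) + 1)) := by
  unfold rate
  rw [div_pow, mul_pow, Real.sq_sqrt (by positivity)]
  field_simp; norm_num

theorem tendsto_rate : Tendsto rate atTop (𝓝 0) := by
  have h : Tendsto (fun n => √(rate n ^ 2)) atTop (𝓝 √(1 / 4 * 0)) := by
    simp_rw [rate_sq]
    exact (tendsto_one_div_add_atTop_nhds_zero_nat.const_mul _).sqrt
  simpa [Real.sqrt_sq (rate_pos _).le] using h

section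

variable {X : Type*} [NormedAddCommGroup X] [NormedSpace ℝ X]

/-- The direction of the line offered in the game when the bands are in the state `σ`; the
functionals `ξ` and `ζ` span the plane in which the game is played. -/
noncomputable def direction (ξ ζ : X →L[ℝ] ℝ) (σ : ℚ × ℕ → Bool) : X →L[ℝ] ℝ :=
  ξ + bandSlope σ • ζ

theorem exists_norm_direction_le (ξ ζ : X →L[ℝ] ℝ) :
    ∃ C : ℝ, 1 ≤ C ∧ ∀ σ, ‖direction ξ ζ σ‖ ≤ C := by
  refine ⟨max 1 (‖ξ‖ + (∑' k, bandWeight k) * ‖ζ‖), le_max_left _ _, fun σ => ?_⟩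
  refine le_trans ?_ (le_max_right _ _)
  refine (norm_add_le _ _).trans ?_
  rw [norm_smul, Real.norm_eq_abs]
  gcongr
  exact abs_bandSlope_le σ

variable (X) in
/-- The data carried from one stage of the construction to the next: the current function `w`, an
open set `U` on which there are a locally constant approximation `P` of its derivative and a locally
constant state `S` of the game, and a scale `δ` below which `w` looks affine. -/
structure Stage where
  /-- The current function. -/
  w : X → ℝ
  /-- The open set of full measure on which the game goes on. -/
  U : Set X
  /-- The locally constant approximation of the derivative. -/
  P : X → X →L[ℝ] ℝ
  /-- The locally constant state of the bands. -/
  S : X → ℚ × ℕ → Bool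
  /-- The scale below which `w` is nearly affine. -/
  δ : ℝ

/-- The invariants of the `n`-th stage; `K` is a compact exhaustion of `Ω`. -/
structure Stage.Valid [MeasurableSpace X] (Ω : Set X) (μ : Measure X) (K : ℕ → Set X) (n : ℕ)
    (s : Stage X) : Prop where
  contDiffOn : ContDiffOn ℝ 2 s.w Ω
  norm_fderiv_lt : ∀ z ∈ Ω, ‖fderiv ℝ s.w z‖ < 1
  isOpen_U : IsOpen s.U
  U_subset : s.U ⊆ Ω
  null : μ (Ω \ s.U) = 0
  locConst_P : ∀ z ∈ s.U, ∀ᶠ z' in 𝓝 z, s.P z' = s.P z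
  locConst_S : ∀ z ∈ s.U, ∀ᶠ z' in 𝓝 z, s.S z' = s.S z
  approx : ∀ z ∈ s.U, ‖s.P z - fderiv ℝ s.w z‖ ≤ rate n / 8 * (1 / 2) ^ n
  δ_pos : 0 < s.δ
  taylor : ∀ z ∈ K n, ∀ h : X, ‖h‖ ≤ s.δ →
    |s.w (z + h) - s.w z - fderiv ℝ s.w z h| ≤ (1 / 2) ^ n * ‖h‖

/-- The relation between the `n`-th stage `s` and the next one `s'`, obtained by adding `g`. -/
structure Stage.Next [MeasurableSpace X] (Ω : Set X) (μ : Measure X) (ω : X → ℝ)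
    (ξ ζ : X →L[ℝ] ℝ) (e : X) (C : ℝ) (n : ℕ) (s s' : Stage X) (g : X → ℝ) : Prop where
  w_eq : s'.w = fun z => s.w z + g z
  contDiff : ContDiff ℝ 2 g
  tsupport_subset : tsupport g ⊆ s.U
  abs_le : ∀ z, |g z| ≤ s.δ * (1 / 2) ^ n
  norm_fderiv_le : ∀ z, ‖fderiv ℝ g z‖ ≤ rate n
  fderiv_near : ∀ z, ∃ t : ℝ, ‖fderiv ℝ g z - t • direction ξ ζ (s.S z)‖ ≤ (1 / 2) ^ n
  U_subset : s'.U ⊆ s.U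
  δ_le : s'.δ ≤ s.δ / 2
  S_eq : ∀ z, s'.S z = bandUpdate (s'.P z e) (s.S z)
  moment : (∫ z in Ω, ω z * (fderiv ℝ s.w z e) ^ 2 ∂μ) + (rate n / (4 * C)) ^ 2 / 2 *
      (∫ z in {z ∈ s.U | ‖s.P z‖ ≤ 1 - rate n}, ω z ∂μ) - (1 / 2) ^ n ≤
    ∫ z in Ω, ω z * (fderiv ℝ s'.w z e) ^ 2 ∂μ

theorem Stage.Valid.isOpen_inner [MeasurableSpace X] {Ω : Set X}
    {μ : Measure X} {K : ℕ → Set X} {n : ℕ} {s : Stage X} (hs : s.Valid Ω μ K n) (r : ℝ) :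
    IsOpen {z ∈ s.U | ‖s.P z‖ ≤ r} := by
  refine isOpen_iff_mem_nhds.2 fun z hz => ?_
  filter_upwards [hs.isOpen_U.mem_nhds hz.1, hs.locConst_P z hz.1] with z' hz' hz''
  exact ⟨hz', by rw [hz'']; exact hz.2⟩

variable [FiniteDimensional ℝ X] [MeasurableSpace X] [BorelSpace X] {μ : Measure X}

theorem exists_locallyConstant_fderiv_approx [SFinite μ] {V : Set X} (hV : IsOpen V) {w : X → ℝ}
    (hw : ContDiffOn ℝ 2 w V) (hw1 : ∀ z ∈ V, ‖fderiv ℝ w z‖ < 1) {η : ℝ} (hη : 0 < η) :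
    ∃ V' ⊆ V, IsOpen V' ∧ μ (V \ V') = 0 ∧ ∃ P : X → X →L[ℝ] ℝ,
      (∀ z ∈ V', ∀ᶠ z' in 𝓝 z, P z' = P z) ∧ ∀ z ∈ V', ‖P z - fderiv ℝ w z‖ ≤ η := by
  have := FiniteDimensional.proper ℝ (X →L[ℝ] ℝ)
  obtain ⟨V', h1, h2, h3, P, h4, h5⟩ := exists_locallyConstant_approx μ hV
    (hw.continuousOn_fderiv_of_isOpen hV one_le_two) (measurable_fderiv ℝ w)
    (isCompact_closedBall (0 : X →L[ℝ] ℝ) 1).totallyBounded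
    (fun z hz => mem_closedBall_zero_iff.2 (hw1 z hz).le) hη
  exact ⟨V', h1, h2, h3, P, h4, fun z hz => by rw [← dist_eq_norm]; exact h5 z hz⟩

theorem integrableOn_weight_mul_fderiv_sq {X : Type*} [NormedAddCommGroup X] [NormedSpace ℝ X]
    [MeasurableSpace X] [BorelSpace X] {μ : Measure X} {Ω : Set X} (hΩ : IsOpen Ω) {w : X → ℝ}
    (hw1 : ∀ z ∈ Ω, ‖fderiv ℝ w z‖ < 1) {ω : X → ℝ} (hω : Integrable ω μ) (e : X) :
    IntegrableOn (fun z => ω z * (fderiv ℝ w z e) ^ 2) Ω μ := by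
  refine (hω.integrableOn (s := Ω)).mul_bdd (c := ‖e‖ ^ 2) ?_ ?_
  · exact ((measurable_fderiv_apply_const ℝ w e).pow_const 2).aestronglyMeasurable
  · filter_upwards [ae_restrict_mem hΩ.measurableSet] with z hz
    rw [norm_pow]
    gcongr
    refine ((fderiv ℝ w z).le_opNorm e).trans (mul_le_of_le_one_left (norm_nonneg _) (hw1 z hz).le)

theorem exists_first_stage [SFinite μ] {Ω : Set X} (hΩ : IsOpen Ω) {K : ℕ → Set X}
    (hK : ∀ n, IsCompact (K n)) (hKΩ : ∀ n, K n ⊆ Ω) {w : X → ℝ}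
    (hw : ContDiffOn ℝ 2 w Ω) (hw1 : ∀ z ∈ Ω, ‖fderiv ℝ w z‖ < 1) {ε : ℝ} (hε : 0 < ε) :
    ∃ s : Stage X, s.Valid Ω μ K 0 ∧ s.w = w ∧ s.δ ≤ ε := by
  have hη : 0 < rate 0 / 8 * (1 / 2) ^ 0 := by have := rate_pos 0; positivity
  obtain ⟨V', h1, h2, h3, P, h4, h5⟩ := exists_locallyConstant_fderiv_approx (μ := μ) hΩ hw hw1 hη
  obtain ⟨δ, hδ, hT⟩ := exists_uniform_taylor hΩ (hK 0) (hKΩ 0) hw (η := (1 / 2) ^ 0) (by norm_num)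
  exact ⟨⟨w, V', P, fun _ _ => true, min δ ε⟩, ⟨hw, hw1, h2, h1, h3, h4,
    fun _ _ => Eventually.of_forall fun _ => rfl, h5, lt_min hδ hε,
    fun z hz h hh => hT z hz h (hh.trans (min_le_left _ _))⟩, rfl, min_le_right _ _⟩

/-- The inductive step. The amplitude `rate n / (4 * C)` on the set where `‖P‖ ≤ 1 - rate n` keeps the
norm of the derivative below `1`. -/
theorem exists_next_stage [μ.IsAddHaarMeasure] {Ω : Set X} (hΩ : IsOpen Ω) {K : ℕ → Set X}
    (hK : ∀ n, IsCompact (K n)) (hKΩ : ∀ n, K n ⊆ Ω) {ω : X → ℝ} (hω : ContDiff ℝ 1 ω)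
    (hω0 : ∀ z, 0 < ω z) (hωi : Integrable ω μ) {ξ ζ : X →L[ℝ] ℝ} {e : X} (hξe : ξ e = 1)
    (hζe : ζ e = 0) {C : ℝ} (hC1 : 1 ≤ C) (hC : ∀ σ, ‖direction ξ ζ σ‖ ≤ C) (n : ℕ)
    (s : Stage X) (hs : s.Valid Ω μ K n) :
    ∃ s' : Stage X, s'.Valid Ω μ K (n + 1) ∧ ∃ g, s.Next Ω μ ω ξ ζ e C n s' g := by
  classical
  set κ := rate n with hκ
  have hκ0 : 0 < κ := rate_pos n
  have hκ1 : κ ≤ 1 / 2 := rate_le_half n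
  set α := κ / (4 * C) with hα
  have hα0 : 0 < α := by positivity
  have hαC : α * C = κ / 4 := by rw [hα]; field_simp
  have hpow : ((1 : ℝ) / 2) ^ n ≤ 1 := pow_le_one₀ (by norm_num) (by norm_num)
  have hpow0 : (0 : ℝ) < (1 / 2) ^ n := by positivity
  set η := min (s.δ * (1 / 2) ^ n) (κ / 8 * (1 / 2) ^ n) with hη
  have hδ := hs.δ_pos
  have hη0 : 0 < η := by positivity
  have hηκ' : η ≤ κ / 8 * (1 / 2) ^ n := min_le_right _ _
  have hηκ : η ≤ κ / 8 := hηκ'.trans (mul_le_of_le_one_right (by positivity) hpow)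
  have hηn : η ≤ (1 / 2) ^ n := hηκ'.trans (mul_le_of_le_one_left hpow0.le (by linarith))
  have hUo := hs.isOpen_U
  set A : X → ℝ := fun z => if ‖s.P z‖ ≤ 1 - κ then α else 0 with hA
  have hAα : ∀ z, |A z| ≤ α := fun z => by
    simp only [hA]; split_ifs
    · exact (abs_of_pos hα0).le
    · rw [abs_zero]; exact hα0.le
  set v : X → X →L[ℝ] ℝ := fun z => direction ξ ζ (s.S z) with hv
  have hxd : ContDiffOn ℝ 1 (fun z => fderiv ℝ s.w z e) s.U :=
    ((hs.contDiffOn.fderiv_of_isOpen hΩ (m := 1) (by norm_num)).clm_apply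
      contDiffOn_const).mono hs.U_subset
  obtain ⟨g, hg, hgU, hgη, hgt, hgA, hgm⟩ := exists_oscillation μ hUo (v := v)
    (fun z hz => (hs.locConst_S z hz).mono fun z' hz' => by simp only [hv, hz'])
    one_ne_zero (e := e) (fun z _ => by simp [hv, direction, hξe, hζe]) (A := A)
    (fun z hz => (hs.locConst_P z hz).mono fun z' hz' => by simp only [hA, hz'])
    hAα hω (fun z => (hω0 z).le) hωi hxd hη0
  have hDg : ∀ z, ‖fderiv ℝ g z‖ ≤ κ / 4 + κ / 8 := fun z => by
    obtain ⟨t, ht, htv⟩ := hgt z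
    have h1 : fderiv ℝ g z = t • v z + (fderiv ℝ g z - t • v z) := by abel
    rw [h1, ← hαC]
    refine (norm_add_le _ _).trans (add_le_add ?_ (htv.trans hηκ))
    rw [norm_smul, Real.norm_eq_abs]
    exact mul_le_mul (ht.trans (hAα z)) (hC _) (norm_nonneg _) hα0.le
  have hDg0 : ∀ z ∉ s.U, fderiv ℝ g z = 0 := fun z hz =>
    image_eq_zero_of_notMem_tsupport fun h => hz (hgU (tsupport_fderiv_subset ℝ h))
  have hdiff : ∀ z ∈ Ω, DifferentiableAt ℝ s.w z := fun z hz =>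
    (hs.contDiffOn.contDiffAt (hΩ.mem_nhds hz)).differentiableAt two_ne_zero
  set w' : X → ℝ := fun z => s.w z + g z with hw'
  have hDw' : ∀ z ∈ Ω, fderiv ℝ w' z = fderiv ℝ s.w z + fderiv ℝ g z := fun z hz =>
    fderiv_fun_add (hdiff z hz) (hg.differentiable two_ne_zero z)
  have hw'd : ContDiffOn ℝ 2 w' Ω := hs.contDiffOn.add hg.contDiffOn
  have hw'1 : ∀ z ∈ Ω, ‖fderiv ℝ w' z‖ < 1 := by
    intro z hz
    rw [hDw' z hz]
    by_cases hzU : z ∈ s.U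
    · by_cases hP : ‖s.P z‖ ≤ 1 - κ
      · have h1 : ‖fderiv ℝ s.w z‖ ≤ 1 - κ + κ / 8 := by
          have h2 : fderiv ℝ s.w z = s.P z - (s.P z - fderiv ℝ s.w z) := by abel
          rw [h2]
          refine (norm_sub_le _ _).trans (add_le_add hP ((hs.approx z hzU).trans ?_))
          exact mul_le_of_le_one_right (by positivity) hpow
        linarith [norm_add_le (fderiv ℝ s.w z) (fderiv ℝ g z), hDg z]
      · rw [hgA z hzU (by simp [hA, hP]), add_zero]
        exact hs.norm_fderiv_lt z hz
    · rw [hDg0 z hzU, add_zero]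
      exact hs.norm_fderiv_lt z hz
  have hη1 : 0 < rate (n + 1) / 8 * (1 / 2) ^ (n + 1) := by have := rate_pos (n + 1); positivity
  obtain ⟨V', h1, h2, h3, P, h4, h5⟩ := exists_locallyConstant_fderiv_approx (μ := μ) hUo
    (hw'd.mono hs.U_subset) (fun z hz => hw'1 z (hs.U_subset hz)) hη1
  obtain ⟨δ, hδ', hT⟩ := exists_uniform_taylor hΩ (hK (n + 1)) (hKΩ (n + 1)) hw'd
    (η := (1 / 2) ^ (n + 1)) (by positivity)
  refine ⟨⟨w', V', P, fun z => bandUpdate (P z e) (s.S z), min δ (s.δ / 2)⟩,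
    ⟨hw'd, hw'1, h2, h1.trans hs.U_subset, ?_, h4, fun z hz => ?_, h5, lt_min hδ' (half_pos hδ),
    fun z hz h hh => hT z hz h (hh.trans (min_le_left _ _))⟩, g,
    ⟨rfl, hg, hgU, fun z => (hgη z).trans (min_le_left _ _), fun z => (hDg z).trans (by linarith),
    fun z => ?_, h1, min_le_right _ _, fun z => rfl, ?_⟩⟩
  · refine measure_mono_null (t := (Ω \ s.U) ∪ (s.U \ V')) (fun z hz => ?_)
      (measure_union_null hs.null h3)
    by_cases hzU : z ∈ s.U
    · exact Or.inr ⟨hzU, hz.2⟩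
    · exact Or.inl ⟨hz.1, hzU⟩
  · filter_upwards [h4 z hz, hs.locConst_S z (h1 hz)] with z' hz' hz''
    simp only [hz', hz'']
  · obtain ⟨t, -, ht⟩ := hgt z
    exact ⟨t, ht.trans hηn⟩
  · set T := {z ∈ s.U | ‖s.P z‖ ≤ 1 - κ} with hT'
    have hTm : MeasurableSet T := (hs.isOpen_inner _).measurableSet
    have hint1 : ∫ z in s.U, ω z * A z ^ 2 ∂μ = α ^ 2 * ∫ z in T, ω z ∂μ := by
      have h6 : ∀ z ∈ s.U, ω z * A z ^ 2 = T.indicator (fun z => α ^ 2 * ω z) z := fun z hz => by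
        by_cases hP : ‖s.P z‖ ≤ 1 - κ
        · rw [indicator_of_mem (show z ∈ T from ⟨hz, hP⟩)]; simp only [hA, if_pos hP]; ring
        · rw [indicator_of_notMem fun h => hP h.2]; simp [hA, if_neg hP]
      rw [setIntegral_congr_fun hUo.measurableSet h6, setIntegral_indicator hTm,
        inter_eq_self_of_subset_right (fun z hz => hz.1), integral_const_mul]
    have hint2 : ∫ z, ω z * ((fderiv ℝ s.w z e + fderiv ℝ g z e) ^ 2 - (fderiv ℝ s.w z e) ^ 2) ∂μ =
        (∫ z in Ω, ω z * (fderiv ℝ w' z e) ^ 2 ∂μ) - ∫ z in Ω, ω z * (fderiv ℝ s.w z e) ^ 2 ∂μ := by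
      rw [← integral_sub (integrableOn_weight_mul_fderiv_sq hΩ hw'1 hωi e)
        (integrableOn_weight_mul_fderiv_sq hΩ hs.norm_fderiv_lt hωi e),
        ← setIntegral_eq_integral_of_forall_compl_eq_zero (s := Ω)]
      · refine setIntegral_congr_fun hΩ.measurableSet fun z hz => ?_
        simp only [hDw' z hz, add_apply]; ring
      · intro z hz
        simp [hDg0 z fun h => hz (hs.U_subset h)]
    rw [hint1, hint2] at hgm
    show _ ≤ ∫ z in Ω, ω z * (fderiv ℝ w' z e) ^ 2 ∂μ
    have h7 : (1 : ℝ) ^ 2 / 2 * (α ^ 2 * ∫ z in T, ω z ∂μ) = α ^ 2 / 2 * ∫ z in T, ω z ∂μ := by ring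
    rw [h7] at hgm
    linarith

end

/-! ### The limit function and its derivative -/

theorem exists_seq_of_step {α : Type*} {P : ℕ → α → Prop} {R : ℕ → α → α → Prop} {a : α}
    (h0 : P 0 a) (hstep : ∀ n a, P n a → ∃ b, P (n + 1) b ∧ R n a b) :
    ∃ s : ℕ → α, s 0 = a ∧ (∀ n, P n (s n)) ∧ ∀ n, R n (s n) (s (n + 1)) := by
  choose! f hf hR using hstep
  have hP : ∀ n, P n (Nat.rec a f n) := fun n => by
    induction n with
    | zero => exact h0
    | succ n ih => exact hf n _ ih
  exact ⟨fun n => Nat.rec a f n, rfl, hP, fun n => hR n _ (hP n)⟩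

section Lipschitz

variable {X : Type*} [NormedAddCommGroup X] [NormedSpace ℝ X] {Ω : Set X} {w : X → ℝ}

/-- Going straight from a point of `Ω` to a point outside, one meets the frontier without the
function having changed by more than the distance. -/
theorem exists_frontier_point (hΩ : IsOpen Ω) (hw : ContinuousOn w (closure Ω))
    (hd : ∀ z ∈ Ω, DifferentiableAt ℝ w z) (hd1 : ∀ z ∈ Ω, ‖fderiv ℝ w z‖ ≤ 1) {x y : X}
    (hx : x ∈ Ω) (hy : y ∉ Ω) :
    ∃ b ∈ frontier Ω, ‖x - b‖ + ‖b - y‖ = ‖x - y‖ ∧ |w x - w b| ≤ ‖x - b‖ := by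
  set γ : ℝ → X := fun t => x + t • (y - x) with hγ
  have hγc : Continuous γ := by fun_prop
  set F := Icc (0 : ℝ) 1 ∩ γ ⁻¹' Ωᶜ
  have hF : IsCompact F := isCompact_Icc.inter_right (hΩ.isClosed_compl.preimage hγc)
  obtain ⟨t, ht, hmin⟩ := hF.exists_isLeast ⟨1, by simp, by simpa [hγ] using hy⟩
  have ht0 : 0 < t := by
    refine lt_of_le_of_ne ht.1.1 fun h => ht.2 ?_
    rw [← h]; simpa [hγ] using hx
  have hin : ∀ r, 0 ≤ r → r < t → γ r ∈ Ω := fun r hr hrt => by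
    by_contra h
    exact absurd (hmin ⟨⟨hr, hrt.le.trans ht.1.2⟩, h⟩) (not_le.2 hrt)
  have hnear : ∀ᶠ r in 𝓝[<] t, 0 ≤ r ∧ r < t :=
    (eventually_nhdsWithin_of_eventually_nhds (eventually_ge_nhds ht0)).and
      eventually_mem_nhdsWithin
  have hlim : Tendsto γ (𝓝[<] t) (𝓝[closure Ω] (γ t)) :=
    tendsto_nhdsWithin_iff.2 ⟨hγc.continuousAt.mono_left nhdsWithin_le_nhds,
      hnear.mono fun r hr => subset_closure (hin r hr.1 hr.2)⟩
  have hcl : γ t ∈ closure Ω := mem_closure_of_tendsto (hγc.continuousAt.mono_left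
    nhdsWithin_le_nhds) (hnear.mono fun r hr => hin r hr.1 hr.2)
  refine ⟨γ t, ⟨hcl, fun h => ht.2 (interior_subset h)⟩, ?_, ?_⟩
  · have h1 : x - γ t = t • (x - y) := by simp only [hγ]; module
    have h2 : γ t - y = (1 - t) • (x - y) := by simp only [hγ]; module
    rw [h1, h2, norm_smul, norm_smul, Real.norm_of_nonneg ht0.le,
      Real.norm_of_nonneg (by linarith [ht.1.2])]
    ring
  · have h1 : ∀ᶠ r in 𝓝[<] t, |w x - w (γ r)| ≤ ‖x - γ r‖ := by
      filter_upwards [hnear] with r hr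
      have hseg : segment ℝ x (γ r) ⊆ Ω := by
        rw [segment_eq_image']
        rintro _ ⟨θ, hθ, rfl⟩
        have : x + θ • (γ r - x) = γ (θ * r) := by simp only [hγ]; module
        show x + θ • (γ r - x) ∈ Ω
        rw [this]
        exact hin _ (mul_nonneg hθ.1 hr.1) (by nlinarith [hθ.1, hθ.2, hr.1, hr.2])
      have := (convex_segment x (γ r)).norm_image_sub_le_of_norm_fderiv_le (𝕜 := ℝ)
        (fun z hz => hd z (hseg hz)) (fun z hz => hd1 z (hseg hz))
        (right_mem_segment ℝ x (γ r)) (left_mem_segment ℝ x (γ r))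
      simpa using this
    have h2 : Tendsto (fun r => |w x - w (γ r)|) (𝓝[<] t) (𝓝 |w x - w (γ t)|) :=
      (tendsto_const_nhds.sub ((hw (γ t) hcl).tendsto.comp hlim)).abs
    have h3 : Tendsto (fun r => ‖x - γ r‖) (𝓝[<] t) (𝓝 ‖x - γ t‖) :=
      (tendsto_const_nhds.sub (hγc.continuousAt.mono_left nhdsWithin_le_nhds)).norm
    exact le_of_tendsto_of_tendsto h2 h3 h1

/-- If a segment between two points of `Ω` leaves `Ω`, the bound comes from the first and the last
point of the frontier on it. -/
theorem lipschitzOnWith_closure_of_frontier (hΩ : IsOpen Ω) (hw : ContinuousOn w (closure Ω))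
    (hd : ∀ z ∈ Ω, DifferentiableAt ℝ w z) (hd1 : ∀ z ∈ Ω, ‖fderiv ℝ w z‖ ≤ 1)
    (hfr : ∀ x ∈ frontier Ω, ∀ y ∈ frontier Ω, |w x - w y| ≤ ‖x - y‖) :
    LipschitzOnWith 1 w (closure Ω) := by
  have hfrontier : ∀ z ∈ closure Ω, z ∉ Ω → z ∈ frontier Ω := fun z hz hz' =>
    ⟨hz, by rwa [hΩ.interior_eq]⟩
  have hmixed : ∀ x ∈ Ω, ∀ y ∈ frontier Ω, |w x - w y| ≤ ‖x - y‖ := by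
    intro x hx y hy
    have hy' : y ∉ Ω := by have := hy.2; rwa [hΩ.interior_eq] at this
    obtain ⟨b, hb, h1, h2⟩ := exists_frontier_point hΩ hw hd hd1 hx hy'
    have h3 := hfr b hb y hy
    have h4 := abs_sub_le (w x) (w b) (w y)
    linarith
  refine LipschitzOnWith.of_dist_le_mul fun x hx y hy => ?_
  rw [Real.dist_eq, dist_eq_norm, NNReal.coe_one, one_mul]
  by_cases hxΩ : x ∈ Ω
  · by_cases hyΩ : y ∈ Ω
    · by_cases hseg : segment ℝ x y ⊆ Ω
      · simpa using (convex_segment x y).norm_image_sub_le_of_norm_fderiv_le (𝕜 := ℝ)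
          (fun z hz => hd z (hseg hz)) (fun z hz => hd1 z (hseg hz))
          (right_mem_segment ℝ x y) (left_mem_segment ℝ x y)
      · obtain ⟨m, hm, hmΩ⟩ := not_subset.1 hseg
        obtain ⟨b, hb, h1, h2⟩ := exists_frontier_point hΩ hw hd hd1 hxΩ hmΩ
        obtain ⟨b', hb', h1', h2'⟩ := exists_frontier_point hΩ hw hd hd1 hyΩ hmΩ
        have h3 : ‖x - m‖ + ‖m - y‖ = ‖x - y‖ := by
          simpa [dist_eq_norm] using dist_add_dist_of_mem_segment hm
        have h4 := hfr b hb b' hb'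
        have h5 : ‖b - b'‖ ≤ ‖b - m‖ + ‖b' - m‖ := by
          rw [norm_sub_rev b' m]; exact norm_sub_le_norm_sub_add_norm_sub _ _ _
        have h6 := abs_sub_le (w x) (w b) (w y)
        have h7 := abs_sub_le (w b) (w b') (w y)
        rw [abs_sub_comm (w b') (w y)] at h7
        rw [norm_sub_rev m y] at h3
        linarith
    · exact hmixed x hxΩ y (hfrontier y hy hyΩ)
  · by_cases hyΩ : y ∈ Ω
    · rw [abs_sub_comm, norm_sub_rev]
      exact hmixed y hyΩ x (hfrontier x hx hxΩ)
    · exact hfr x (hfrontier x hx hxΩ) y (hfrontier y hy hyΩ)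

end Lipschitz

section Limit

variable {X : Type*} [NormedAddCommGroup X] [NormedSpace ℝ X] [MeasurableSpace X]
  {Ω : Set X} {μ : Measure X} {K : ℕ → Set X} {ω : X → ℝ} {ξ ζ : X →L[ℝ] ℝ} {e₁ e₂ : X} {C : ℝ}
  {s : ℕ → Stage X} {g : ℕ → X → ℝ}

theorem fderiv_succ_stage (hΩ : IsOpen Ω) (hs : ∀ n, (s n).Valid Ω μ K n)
    (hg : ∀ n, (s n).Next Ω μ ω ξ ζ e₁ C n (s (n + 1)) (g n)) {z : X} (hz : z ∈ Ω) (n : ℕ) :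
    fderiv ℝ (s (n + 1)).w z = fderiv ℝ (s n).w z + fderiv ℝ (g n) z := by
  rw [(hg n).w_eq]
  exact fderiv_fun_add (((hs n).contDiffOn.contDiffAt (hΩ.mem_nhds hz)).differentiableAt
    two_ne_zero) ((hg n).contDiff.differentiable two_ne_zero z)

theorem summable_const_mul_half_pow (c : ℝ) : Summable fun n : ℕ => c * (1 / 2 : ℝ) ^ n :=
  summable_geometric_two.mul_left c

/-- Pointwise convergence of the derivatives: points that leave some `U` are not moved any more, and
at the others the game is played forever. -/
theorem exists_tendsto_fderiv [FiniteDimensional ℝ X] (hΩ : IsOpen Ω)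
    (hs : ∀ n, (s n).Valid Ω μ K n)
    (hg : ∀ n, (s n).Next Ω μ ω ξ ζ e₁ C n (s (n + 1)) (g n))
    (h11 : ξ e₁ = 1) (h21 : ζ e₁ = 0) (h12 : ξ e₂ = 0) (h22 : ζ e₂ = 1) {z : X} (hz : z ∈ Ω) :
    ∃ p, Tendsto (fun n => fderiv ℝ (s n).w z) atTop (𝓝 p) := by
  have hstep := fderiv_succ_stage hΩ hs hg hz
  have hUanti : Antitone fun n => (s n).U := antitone_nat_of_succ_le fun n => (hg n).U_subset
  by_cases hU : ∀ n, z ∈ (s n).U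
  · set P : ℕ → X →L[ℝ] ℝ := fun n => (s n).P z with hP
    set D : ℕ → X →L[ℝ] ℝ := fun n => fderiv ℝ (s n).w z with hD
    have happ : ∀ n, ‖P n - D n‖ ≤ 1 / 2 * (1 / 2) ^ n := fun n => by
      refine ((hs n).approx z (hU n)).trans ?_
      have := rate_le_half n
      gcongr
      · linarith
      · norm_num
    choose t ht using fun n => (hg n).fderiv_near z
    set v : ℕ → X →L[ℝ] ℝ := fun n => direction ξ ζ ((s n).S z) with hv
    set E : ℕ → X →L[ℝ] ℝ := fun n => P (n + 1) - P n - t n • v n with hE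
    have hEn : ∀ n, ‖E n‖ ≤ 2 * (1 / 2) ^ n := fun n => by
      have h1 : E n = (P (n + 1) - D (n + 1)) + (fderiv ℝ (g n) z - t n • v n)
          - (P n - D n) := by
        simp only [hE, hD, hstep n]; abel
      rw [h1]
      have h2 := happ (n + 1)
      rw [pow_succ] at h2
      have h3 := norm_sub_le ((P (n + 1) - D (n + 1)) + (fderiv ℝ (g n) z - t n • v n)) (P n - D n)
      have h4 := norm_add_le (P (n + 1) - D (n + 1)) (fderiv ℝ (g n) z - t n • v n)
      have h5 : ‖fderiv ℝ (g n) z - t n • v n‖ ≤ (1 / 2) ^ n := ht n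
      have h6 : (0 : ℝ) ≤ (1 / 2) ^ n := by positivity
      linarith [happ n]
    have hEe : ∀ (e : X) n, |E n e| ≤ 2 * ‖e‖ * (1 / 2) ^ n := fun e n => by
      rw [← Real.norm_eq_abs]
      have := (E n).le_opNorm e
      nlinarith [hEn n, norm_nonneg e]
    have hEs : ∀ e : X, Summable fun n => |E n e| := fun e =>
      Summable.of_nonneg_of_le (fun _ => abs_nonneg _) (hEe e) (summable_const_mul_half_pow _)
    have hPn : ∀ n, ‖P n‖ ≤ 2 := fun n => by
      have h1 : P n = (P n - D n) + D n := by abel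
      rw [h1]
      refine (norm_add_le _ _).trans ?_
      have h2 : ((1 : ℝ) / 2) ^ n ≤ 1 := pow_le_one₀ (by norm_num) (by norm_num)
      have h3 : ‖D n‖ < 1 := (hs n).norm_fderiv_lt z hz
      linarith [happ n]
    have hPe : ∀ (e : X) n, |P n e| ≤ 2 * ‖e‖ := fun e n =>
      ((P n).le_opNorm e).trans (by have := hPn n; gcongr)
    have hPs : ∀ n, P (n + 1) = P n + t n • v n + E n := fun n => by simp only [hE]; abel
    obtain ⟨⟨x', hx'⟩, y', hy'⟩ := game_converges (x := fun n => P n e₁) (y := fun n => P n e₂)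
      (t := t) (a := fun n => E n e₁) (b := fun n => E n e₂) (σ := fun n => (s n).S z)
      (R := 2 * ‖e₁‖ + 2 * ‖e₂‖) (fun n => (hg n).S_eq z)
      (fun n => (hPe e₁ n).trans (by linarith [norm_nonneg e₂]))
      (fun n => (hPe e₂ n).trans (by linarith [norm_nonneg e₁]))
      (fun n => by simp only [hPs n, hv, direction]; simp [h11, h21])
      (fun n => by simp only [hPs n, hv, direction]; simp [h12, h22]) (hEs e₁) (hEs e₂)
    -- the component of `P` outside the plane of the game moves by the errors only
    set Q : ℕ → X →L[ℝ] ℝ := fun n => P n - P n e₁ • ξ - P n e₂ • ζ with hQ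
    have hQs : ∀ n, Q (n + 1) - Q n = E n - E n e₁ • ξ - E n e₂ • ζ := fun n => by
      ext u
      simp only [hQ, hPs n, hv, direction]
      simp [h11, h21, h12, h22]
      ring
    have hQc : CauchySeq Q := by
      refine cauchySeq_of_le_geometric (1 / 2) (2 + 2 * ‖e₁‖ * ‖ξ‖ + 2 * ‖e₂‖ * ‖ζ‖) (by norm_num)
        fun n => ?_
      rw [dist_eq_norm, norm_sub_rev, hQs]
      refine (norm_sub_le _ _).trans ((add_le_add (norm_sub_le _ _) le_rfl).trans ?_)
      rw [norm_smul, norm_smul, Real.norm_eq_abs, Real.norm_eq_abs]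
      have h1 := mul_le_mul_of_nonneg_right (hEe e₁ n) (norm_nonneg ξ)
      have h2 := mul_le_mul_of_nonneg_right (hEe e₂ n) (norm_nonneg ζ)
      linarith [hEn n]
    have := FiniteDimensional.complete ℝ (X →L[ℝ] ℝ)
    obtain ⟨q, hq⟩ := cauchySeq_tendsto_of_complete hQc
    have hPlim : Tendsto P atTop (𝓝 (q + x' • ξ + y' • ζ)) :=
      ((hq.add (hx'.smul_const ξ)).add (hy'.smul_const ζ)).congr fun n => by
        simp only [hQ]; abel
    have hPD : Tendsto (fun n => P n - D n) atTop (𝓝 0) :=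
      squeeze_zero_norm happ (summable_const_mul_half_pow _).tendsto_atTop_zero
    exact ⟨_, (hPlim.sub hPD).congr fun n => by abel⟩
  · push Not at hU
    obtain ⟨m, hm⟩ := hU
    refine ⟨fderiv ℝ (s m).w z, tendsto_const_nhds.congr' ?_⟩
    filter_upwards [eventually_ge_atTop m] with n hn
    induction n, hn using Nat.le_induction with
    | base => rfl
    | succ n hn ih =>
      have h0 : fderiv ℝ (g n) z = 0 := image_eq_zero_of_notMem_tsupport fun h =>
        hm (hUanti hn ((hg n).tsupport_subset (tsupport_fderiv_subset ℝ h)))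
      rw [hstep n, h0, add_zero]; exact ih

theorem stage_δ_anti (hs : ∀ n, (s n).Valid Ω μ K n)
    (hg : ∀ n, (s n).Next Ω μ ω ξ ζ e₁ C n (s (n + 1)) (g n)) : Antitone fun n => (s n).δ :=
  antitone_nat_of_succ_le fun n => by linarith [(hg n).δ_le, (hs n).δ_pos]

theorem tendsto_stage_δ (hs : ∀ n, (s n).Valid Ω μ K n)
    (hg : ∀ n, (s n).Next Ω μ ω ξ ζ e₁ C n (s (n + 1)) (g n)) :
    Tendsto (fun n => (s n).δ) atTop (𝓝 0) := by
  have h : ∀ n, (s n).δ ≤ (s 0).δ * (1 / 2) ^ n := fun n => by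
    induction n with
    | zero => simp
    | succ n ih => rw [pow_succ]; linarith [(hg n).δ_le]
  exact squeeze_zero (fun n => (hs n).δ_pos.le) h
    (summable_const_mul_half_pow _).tendsto_atTop_zero

theorem abs_increment_le (hs : ∀ n, (s n).Valid Ω μ K n)
    (hg : ∀ n, (s n).Next Ω μ ω ξ ζ e₁ C n (s (n + 1)) (g n)) (n k : ℕ) (z : X) :
    ‖g (k + n) z‖ ≤ (s n).δ * (1 / 2) ^ n * (1 / 2) ^ k := by
  refine ((hg (k + n)).abs_le z).trans ?_
  rw [mul_assoc, ← pow_add, add_comm n k]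
  have := stage_δ_anti hs hg (Nat.le_add_left n k)
  gcongr

theorem stage_eq_sum (hg : ∀ n, (s n).Next Ω μ ω ξ ζ e₁ C n (s (n + 1)) (g n)) (n : ℕ) (z : X) :
    (s n).w z = (s 0).w z + ∑ i ∈ Finset.range n, g i z := by
  induction n with
  | zero => simp
  | succ n ih => rw [Finset.sum_range_succ, (hg n).w_eq]; simp only [ih]; ring

theorem abs_limit_sub_stage_le (hs : ∀ n, (s n).Valid Ω μ K n)
    (hg : ∀ n, (s n).Next Ω μ ω ξ ζ e₁ C n (s (n + 1)) (g n)) (n : ℕ) (z : X) :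
    |(s 0).w z + ∑' i, g i z - (s n).w z| ≤ 2 * ((s n).δ * (1 / 2) ^ n) := by
  have hsum : Summable fun i => g i z :=
    Summable.of_norm_bounded (summable_const_mul_half_pow ((s 0).δ * (1 / 2) ^ 0))
      fun i => abs_increment_le hs hg 0 i z
  rw [stage_eq_sum hg n z, add_sub_add_left_eq_sub, ← hsum.sum_add_tsum_nat_add n,
    add_sub_cancel_left, ← Real.norm_eq_abs, mul_comm]
  exact tsum_of_norm_bounded (hasSum_geometric_two.mul_left _) fun k => abs_increment_le hs hg n k z

/-- Differentiability of the limit. At distances between two consecutive scales, the earlier stage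
is nearly affine, the next increment has a small derivative and the others are negligible. -/
theorem hasFDerivAt_limit (hs : ∀ n, (s n).Valid Ω μ K n)
    (hg : ∀ n, (s n).Next Ω μ ω ξ ζ e₁ C n (s (n + 1)) (g n)) {z : X} {m : ℕ}
    (hz : ∀ n ≥ m, z ∈ K n) {p : X →L[ℝ] ℝ}
    (hp : Tendsto (fun n => fderiv ℝ (s n).w z) atTop (𝓝 p)) :
    HasFDerivAt (fun z => (s 0).w z + ∑' i, g i z) p z := by
  set w : X → ℝ := fun z => (s 0).w z + ∑' i, g i z with hw
  have htail := abs_limit_sub_stage_le hs hg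
  have herr : Tendsto (fun n => ‖fderiv ℝ (s n).w z - p‖ + rate n + 3 * (1 / 2) ^ n) atTop (𝓝 0) := by
    have h1 := tendsto_iff_norm_sub_tendsto_zero.1 hp
    simpa using (h1.add tendsto_rate).add (summable_const_mul_half_pow 3).tendsto_atTop_zero
  rw [hasFDerivAt_iff_isLittleO_nhds_zero, Asymptotics.isLittleO_iff]
  intro c hc
  obtain ⟨N, hN⟩ := eventually_atTop.1 (herr.eventually (gt_mem_nhds hc))
  set M := max N m
  filter_upwards [Metric.closedBall_mem_nhds (0 : X) (hs M).δ_pos] with h hh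
  rw [mem_closedBall_zero_iff] at hh
  by_cases hh0 : h = 0
  · simp [hh0]
  have hpos : 0 < ‖h‖ := norm_pos_iff.2 hh0
  have hex : ∃ k, (s k).δ < ‖h‖ :=
    ((tendsto_stage_δ hs hg).eventually (gt_mem_nhds hpos)).exists
  classical
  obtain ⟨n, hn1, hn2, hn3⟩ : ∃ n, M ≤ n ∧ (s (n + 1)).δ < ‖h‖ ∧ ‖h‖ ≤ (s n).δ := by
    have hk := Nat.find_spec hex
    have hMk : M < Nat.find hex := by
      by_contra hle
      exact absurd (hk.trans_le hh) (not_lt.2 (stage_δ_anti hs hg (not_lt.1 hle)))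
    refine ⟨Nat.find hex - 1, by omega, ?_, not_lt.1 (Nat.find_min hex (by omega))⟩
    rwa [Nat.sub_add_cancel (by omega)]
  have hb := hN n ((le_max_left _ _).trans hn1)
  have h1 := (hs n).taylor z (hz n ((le_max_right _ _).trans hn1)) h hn3
  have h2 : |(fderiv ℝ (s n).w z - p) h| ≤ ‖fderiv ℝ (s n).w z - p‖ * ‖h‖ :=
    (fderiv ℝ (s n).w z - p).le_opNorm h
  have h3 : |g n (z + h) - g n z| ≤ rate n * ‖h‖ := by
    have := Convex.norm_image_sub_le_of_norm_fderiv_le (𝕜 := ℝ) (f := g n) (s := univ)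
      (fun x _ => (hg n).contDiff.differentiable two_ne_zero x)
      (fun x _ => (hg n).norm_fderiv_le x) convex_univ (mem_univ z) (mem_univ (z + h))
    simpa using this
  have h4 : ∀ x, |w x - (s (n + 1)).w x| ≤ (1 / 2) ^ n * ‖h‖ := fun x => by
    refine (htail (n + 1) x).trans ?_
    rw [pow_succ]
    have : (0 : ℝ) ≤ (1 / 2) ^ n := by positivity
    nlinarith
  have h5 : w (z + h) - w z - p h =
      ((s n).w (z + h) - (s n).w z - fderiv ℝ (s n).w z h) + (fderiv ℝ (s n).w z - p) h +
      (g n (z + h) - g n z) + (w (z + h) - (s (n + 1)).w (z + h)) - (w z - (s (n + 1)).w z) := by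
    rw [(hg n).w_eq, sub_apply]; ring
  rw [h5, Real.norm_eq_abs]
  have a1 := abs_sub (((s n).w (z + h) - (s n).w z - fderiv ℝ (s n).w z h) +
    (fderiv ℝ (s n).w z - p) h + (g n (z + h) - g n z) + (w (z + h) - (s (n + 1)).w (z + h)))
    (w z - (s (n + 1)).w z)
  have a2 := abs_add_le (((s n).w (z + h) - (s n).w z - fderiv ℝ (s n).w z h) +
    (fderiv ℝ (s n).w z - p) h + (g n (z + h) - g n z)) (w (z + h) - (s (n + 1)).w (z + h))
  have a3 := abs_add_three ((s n).w (z + h) - (s n).w z - fderiv ℝ (s n).w z h)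
    ((fderiv ℝ (s n).w z - p) h) (g n (z + h) - g n z)
  have h6 := h4 (z + h)
  have h7 := h4 z
  nlinarith

end Limit

/-! ### The norm of the derivative almost everywhere -/

section AlmostEverywhere

variable {X : Type*} [NormedAddCommGroup X] [NormedSpace ℝ X] [MeasurableSpace X]
  {Ω : Set X} {μ : Measure X} {K : ℕ → Set X} {ω : X → ℝ} {ξ ζ : X →L[ℝ] ℝ} {e : X} {C : ℝ}
  {s : ℕ → Stage X} {g : ℕ → X → ℝ}

/-- The points which, from some stage on, are always moved form a null set: otherwise the bounded
second moments of the derivatives would grow at least like the harmonic series. -/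
theorem measure_always_moved_eq_zero [BorelSpace X] (hΩ : IsOpen Ω)
    (hs : ∀ n, (s n).Valid Ω μ K n)
    (hg : ∀ n, (s n).Next Ω μ ω ξ ζ e C n (s (n + 1)) (g n)) (hC : 0 < C) (hω0 : ∀ z, 0 < ω z)
    (hωi : Integrable ω μ) (N : ℕ) :
    μ (⋂ k, {z ∈ (s (k + N)).U | ‖(s (k + N)).P z‖ ≤ 1 - rate (k + N)}) = 0 := by
  set A : ℕ → Set X := fun n => {z ∈ (s n).U | ‖(s n).P z‖ ≤ 1 - rate n} with hA
  have hAm : ∀ n, MeasurableSet (A n) := fun n => ((hs n).isOpen_inner _).measurableSet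
  set B := ⋂ k, A (k + N) with hB
  have hBm : MeasurableSet B := MeasurableSet.iInter fun k => hAm _
  set a := ∫ z in B, ω z ∂μ with ha
  set E : ℕ → ℝ := fun n => ∫ z in Ω, ω z * (fderiv ℝ (s n).w z e) ^ 2 ∂μ with hE
  have hE0 : ∀ n, 0 ≤ E n := fun n => integral_nonneg fun z =>
    mul_nonneg (hω0 z).le (sq_nonneg _)
  have hE1 : ∀ n, E n ≤ ∫ z in Ω, ω z * ‖e‖ ^ 2 ∂μ := fun n => by
    refine setIntegral_mono_on
      (integrableOn_weight_mul_fderiv_sq hΩ (hs n).norm_fderiv_lt hωi e)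
      (hωi.integrableOn.mul_const _) hΩ.measurableSet fun z hz => ?_
    have h1 := hω0 z
    have h2 : |fderiv ℝ (s n).w z e| ≤ ‖e‖ := ((fderiv ℝ (s n).w z).le_opNorm e).trans
      (mul_le_of_le_one_left (norm_nonneg _) ((hs n).norm_fderiv_lt z hz).le)
    rw [← sq_abs (fderiv ℝ (s n).w z e)]
    gcongr
  have ha0 : 0 ≤ a := integral_nonneg fun z => (hω0 z).le
  set c := 1 / (128 * C ^ 2) * a with hc
  have hstep : ∀ k, c * (1 / ((k + N : ℕ) + 1 : ℝ)) ≤ E (k + 1 + N) - E (k + N) + (1 / 2) ^ k := by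
    intro k
    have h1 := (hg (k + N)).moment
    have h2 : a ≤ ∫ z in A (k + N), ω z ∂μ :=
      setIntegral_mono_set hωi.integrableOn (Eventually.of_forall fun z => (hω0 z).le)
        (LE.le.eventuallyLE (iInter_subset _ k))
    have h3 : ((1 : ℝ) / 2) ^ (k + N) ≤ (1 / 2) ^ k :=
      pow_le_pow_of_le_one (by norm_num) (by norm_num) (Nat.le_add_right k N)
    have h4 : (rate (k + N) / (4 * C)) ^ 2 / 2 * a = c * (1 / ((k + N : ℕ) + 1 : ℝ)) := by
      rw [div_pow, rate_sq, hc]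
      field_simp
      ring
    have h5 : (rate (k + N) / (4 * C)) ^ 2 / 2 * a ≤
        (rate (k + N) / (4 * C)) ^ 2 / 2 * ∫ z in A (k + N), ω z ∂μ := by gcongr
    rw [show k + 1 + N = k + N + 1 by ring]
    simp only [hE]
    linarith
  have ha' : a = 0 := by
    by_contra hne
    have hapos : 0 < a := lt_of_le_of_ne ha0 (Ne.symm hne)
    have hcpos : 0 < c := by positivity
    have hsum : Summable fun k : ℕ => c * (1 / ((k + N : ℕ) + 1 : ℝ)) := by
      refine summable_of_sum_range_le (c := (∫ z in Ω, ω z * ‖e‖ ^ 2 ∂μ) + 2)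
        (fun k => by positivity) fun n => ?_
      have h1 : ∑ k ∈ Finset.range n, c * (1 / ((k + N : ℕ) + 1 : ℝ)) ≤
          ∑ k ∈ Finset.range n, (E (k + 1 + N) - E (k + N) + (1 / 2) ^ k) :=
        Finset.sum_le_sum fun k _ => hstep k
      rw [Finset.sum_add_distrib, Finset.sum_range_sub (fun k => E (k + N))] at h1
      have h2 := summable_geometric_two.sum_le_tsum (Finset.range n) fun k _ => by positivity
      rw [tsum_geometric_two] at h2
      linarith [hE0 (0 + N), hE1 (n + N)]
    have h1 := (summable_mul_left_iff hcpos.ne').1 hsum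
    refine Real.not_summable_one_div_natCast ((summable_nat_add_iff (N + 1)).1 (h1.congr fun k => ?_))
    push_cast
    rw [add_assoc]
  by_contra hne
  have hpos : 0 < a := (setIntegral_pos_iff_support_of_nonneg_ae
    (Eventually.of_forall fun z => (hω0 z).le) hωi.integrableOn).2 (by
      rw [Function.support_eq_univ fun z => (hω0 z).ne', univ_inter]
      exact pos_iff_ne_zero.2 hne)
  exact hpos.ne' ha'

/-- Where the limit of the derivatives has norm less than `1`, the point is moved at all late stages,
because `rate n` tends to `0`. -/
theorem ae_one_le_norm_limit [BorelSpace X] (hΩ : IsOpen Ω) (hs : ∀ n, (s n).Valid Ω μ K n)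
    (hg : ∀ n, (s n).Next Ω μ ω ξ ζ e C n (s (n + 1)) (g n)) (hC : 0 < C) (hω0 : ∀ z, 0 < ω z)
    (hωi : Integrable ω μ) {p : X → X →L[ℝ] ℝ}
    (hp : ∀ z ∈ Ω, Tendsto (fun n => fderiv ℝ (s n).w z) atTop (𝓝 (p z))) :
    ∀ᵐ z ∂μ.restrict Ω, 1 ≤ ‖p z‖ := by
  have h1 : ∀ᵐ z ∂μ.restrict Ω, ∀ n, z ∈ (s n).U := by
    refine ae_all_iff.2 fun n => ?_
    rw [ae_restrict_iff' hΩ.measurableSet, ae_iff]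
    refine measure_mono_null (fun z hz => ?_) (hs n).null
    simpa using hz
  have h2 : ∀ᵐ z ∂μ.restrict Ω, ∀ N,
      z ∉ ⋂ k, {z ∈ (s (k + N)).U | ‖(s (k + N)).P z‖ ≤ 1 - rate (k + N)} := by
    refine ae_all_iff.2 fun N => ae_restrict_of_ae ?_
    exact measure_eq_zero_iff_ae_notMem.1 (measure_always_moved_eq_zero hΩ hs hg hC hω0 hωi N)
  filter_upwards [h1, h2, ae_restrict_mem hΩ.measurableSet] with z hzU hzN hz
  by_contra! hlt
  have hPD : Tendsto (fun n => (s n).P z - fderiv ℝ (s n).w z) atTop (𝓝 0) := by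
    refine squeeze_zero_norm (a := fun n => 1 / 8 * (1 / 2) ^ n) (fun n => ?_)
      (summable_const_mul_half_pow _).tendsto_atTop_zero
    refine ((hs n).approx z (hzU n)).trans ?_
    have := rate_le_half n
    gcongr
    linarith
  have hP : Tendsto (fun n => ‖(s n).P z‖ + rate n) atTop (𝓝 ‖p z‖) := by
    have := ((hPD.add (hp z hz)).norm).add tendsto_rate
    simpa using this
  obtain ⟨N, hN⟩ := eventually_atTop.1 (hP.eventually (gt_mem_nhds hlt))
  refine hzN N (mem_iInter.2 fun k => ⟨hzU _, ?_⟩)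
  linarith [hN (k + N) (Nat.le_add_left N k)]

end AlmostEverywhere

/-! ### Conclusion -/

theorem exists_lipschitz_of_lipConst_lt_one {X : Type*} [PseudoMetricSpace X] {f : X → ℝ}
    {E : Set X} (h : lipConst f E < 1) : ∃ L : ℝ≥0, L < 1 ∧ LipschitzOnWith L f E := by
  simp only [lipConst, iInf_lt_iff] at h
  obtain ⟨L, ⟨-, hL⟩, hL1⟩ := h
  exact ⟨L, by exact_mod_cast hL1, LipschitzOnWith.of_dist_le_mul fun x hx y hy => by
    rw [Real.dist_eq]; exact hL x hx y hy⟩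

theorem theorem1p4 {X : Type*} [NormedAddCommGroup X] [NormedSpace ℝ X] [FiniteDimensional ℝ X]
    [MeasurableSpace X] [BorelSpace X] (μ : MeasureTheory.Measure X) [μ.IsAddHaarMeasure]
    (hdim : 2 ≤ Module.finrank ℝ X) (Ω : Set X) (hΩ : IsOpen Ω) (u₀ : X → ℝ)
    (hu₀ : LipschitzOnWith 1 u₀ (closure Ω)) (hbd : lipConst u₀ (frontier Ω) < 1)
    (ε : ℝ) (hε : 0 < ε) :
    ∃ w : X → ℝ,
      LipschitzOnWith 1 w (closure Ω) ∧
      (∀ x ∈ Ω, DifferentiableAt ℝ w x) ∧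
      (∀ᵐ x ∂(μ.restrict Ω), ‖fderiv ℝ w x‖ = 1) ∧
      (∀ x ∈ frontier Ω, w x = u₀ x) ∧
      ∀ x ∈ closure Ω, |u₀ x - w x| ≤ ε := by
  have := FiniteDimensional.proper ℝ X
  have hfrontier : ∀ z ∈ frontier Ω, z ∈ closure Ω ∧ z ∉ Ω := fun z hz =>
    ⟨hz.1, by have := hz.2; rwa [hΩ.interior_eq] at this⟩
  -- the smooth starting function
  obtain ⟨L, hL1, hL⟩ := exists_lipschitz_of_lipConst_lt_one hbd
  obtain ⟨u, hu, huu₀⟩ := hu₀.extend_real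
  obtain ⟨v, hv, hvu₀⟩ := hL.extend_real
  obtain ⟨u₁, hu₁v, hu₁u, c, hc, hc0, hc1, hu₁⟩ :=
    exists_locally_strict_lipschitz hu hv hL1 (show 0 < ε / 3 by positivity)
  obtain ⟨w₀, hw₀, hw₀1, hw₀c, hw₀u₁, hw₀ε⟩ :=
    exists_smoothing hΩ hc hc0 hc1 hu₁ (show 0 < ε / 3 by positivity)
  have hw₀fr : ∀ z ∈ frontier Ω, w₀ z = u₀ z := fun z hz => by
    obtain ⟨hzc, hzΩ⟩ := hfrontier z hz
    rw [hw₀u₁ z hzΩ, hu₁v z (by rw [← hvu₀ hz, huu₀ hzc]), huu₀ hzc]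
  -- the stages
  obtain ⟨ξ, ζ, e₁, e₂, h11, h21, h12, h22⟩ := exists_dual_pair hdim
  obtain ⟨C, hC1, hC⟩ := exists_norm_direction_le ξ ζ
  obtain ⟨ω, hω, hω0, hωi⟩ := exists_weight μ
  obtain ⟨K, hK, hKK, -, hKΩ⟩ := exists_compact_exhaustion hΩ
  have hKsub : ∀ n, K n ⊆ Ω := fun n => hKΩ ▸ subset_iUnion K n
  obtain ⟨s₀, hs₀, rfl, hδ₀⟩ := exists_first_stage (μ := μ) hΩ hK hKsub hw₀ hw₀1
    (show 0 < ε / 6 by positivity)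
  obtain ⟨s, rfl, hs, hnext⟩ := exists_seq_of_step
    (P := fun n (s : Stage X) => s.Valid Ω μ K n)
    (R := fun n s s' => ∃ g, Stage.Next Ω μ ω ξ ζ e₁ C n s s' g) hs₀
    (exists_next_stage hΩ hK hKsub hω hω0 hωi h11 h21 hC1 hC)
  choose g hg using hnext
  have hp : ∀ z ∈ Ω, ∃ p, Tendsto (fun n => fderiv ℝ (s n).w z) atTop (𝓝 p) := fun z hz =>
    exists_tendsto_fderiv hΩ hs hg h11 h21 h12 h22 hz
  choose! p hp using hp
  set w : X → ℝ := fun z => (s 0).w z + ∑' i, g i z with hw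
  have hderiv : ∀ z ∈ Ω, HasFDerivAt w (p z) z := by
    intro z hz
    obtain ⟨m, hm⟩ := mem_iUnion.1 (hKΩ.symm ▸ hz)
    exact hasFDerivAt_limit hs hg
      (fun n hn => monotone_of_subset_interior_succ hKK hn hm) (hp z hz)
  have hp1 : ∀ z ∈ Ω, ‖p z‖ ≤ 1 := fun z hz =>
    le_of_tendsto (hp z hz).norm (Eventually.of_forall fun n => ((hs n).norm_fderiv_lt z hz).le)
  have hg0 : ∀ z ∉ Ω, ∀ n, g n z = 0 := fun z hz n => image_eq_zero_of_notMem_tsupport fun h =>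
    hz ((hs n).U_subset ((hg n).tsupport_subset h))
  have hwfr : ∀ z ∈ frontier Ω, w z = u₀ z := fun z hz => by
    simp [hw, hg0 z (hfrontier z hz).2, hw₀fr z hz]
  have hwc : Continuous w := hw₀c.add (continuous_tsum (fun n => (hg n).contDiff.continuous)
    (summable_const_mul_half_pow ((s 0).δ * (1 / 2) ^ 0)) fun n z => abs_increment_le hs hg 0 n z)
  refine ⟨w, ?_, fun z hz => (hderiv z hz).differentiableAt, ?_, hwfr, fun z hz => ?_⟩
  · refine lipschitzOnWith_closure_of_frontier hΩ hwc.continuousOn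
      (fun z hz => (hderiv z hz).differentiableAt)
      (fun z hz => by rw [(hderiv z hz).fderiv]; exact hp1 z hz) fun x hx y hy => ?_
    rw [hwfr x hx, hwfr y hy]
    simpa [Real.dist_eq, dist_eq_norm] using
      hu₀.dist_le_mul x (hfrontier x hx).1 y (hfrontier y hy).1
  · filter_upwards [ae_one_le_norm_limit hΩ hs hg (by linarith) hω0 hωi hp,
      ae_restrict_mem hΩ.measurableSet] with z hz hzΩ
    rw [(hderiv z hzΩ).fderiv]
    exact le_antisymm (hp1 z hzΩ) hz
  · have h1 := hu₁u z
    have h2 := hw₀ε z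
    have h3 := abs_limit_sub_stage_le hs hg 0 z
    rw [huu₀ hz]
    have h4 : u z - w z = -(u₁ z - u z) - ((s 0).w z - u₁ z) - (w z - (s 0).w z) := by ring
    rw [h4]
    have h5 : |w z - (s 0).w z| ≤ 2 * ((s 0).δ * (1 / 2) ^ 0) := h3
    rw [pow_zero, mul_one] at h5
    have a1 := abs_sub (-(u₁ z - u z) - ((s 0).w z - u₁ z)) (w z - (s 0).w z)
    have a2 := abs_sub (-(u₁ z - u z)) ((s 0).w z - u₁ z)
    rw [abs_neg] at a2
    linarith
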